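/- \textbf{Setting.} Let $X$ be a measurable space, $Y\subseteq\mathbb{R}$, and $\rho$ a probability measure on $X\times Y$. Let $\Phi:X\to\mathcal{F}$ be a measurable map into a real separable Hilbert space $\mathcal{F}$, and let $V:\mathbb{R}\times\mathbb{R}\to[0,\infty)$ be measurable. Write $\mathcal{E}(w)=\int_{X\times Y} V(y,\langle w,\Phi(x)\rangle)\,d\rho(x,y)$ for $w\in\mathcal{F}$. Assume: (1) $V(y,\cdot)$ is convex for every $y\in Y$, and there are constants $\kappa,v_0,a_0$ with $\|\Phi(x)\|\le\kappa$, $V(y,0)\le v_0$ and $|V'_-(y,a)|\le a_0$ for all $x\in X$, $y\in Y$, $a\in\mathbb{R}$, where $V'_-(y,\cdot)$ is the left-hand derivative of $V(y,\cdot)$ (the loss is not assumed to be smooth); (2) for some $\beta\in(0,1]$ and $c_\beta>0$, $$\inf_{w\in\mathcal{F}}\Big\{\mathcal{E}(w)+\tfrac{\lambda}{2}\|w\|^2\Big\}-\inf_{w\in\mathcal{F}}\mathcal{E}(w)\le c_\beta\lambda^\beta\qquad\text{for all }\lambda>0.$$ Let $m\ge1$, let $z_i=(x_i,y_i)$, $i=1,\dots,m$,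 be independent with law $\rho$, and let $j_1,j_2,\dots$ be independent and uniformly distributed on $\{1,\dots,m\}$, independently of the sample. With $\eta_t=t^{-2\beta/(2\beta+1)}$, the stochastic gradient method is $w_1=0$, $$w_{t+1}=w_t-\eta_t\,V'_-\big(y_{j_t},\langle w_t,\Phi(x_{j_t})\rangle\big)\,\Phi(x_{j_t}),\qquad t\ge1,$$ and $\overline{w}_t=\sum_{k=1}^t\eta_kw_k\big/\sum_{k=1}^t\eta_k$ are its weighted averages. Let $\mathbb{E}$ denote the expectation over the sample and the indices. \textbf{Corollary 8.} There is a constant $C>0$, depending only on $\kappa,v_0,a_0,c_\beta$, such that for $g_t=\overline{w}_t$ as well as for $g_t=w_t$, and for all integers $m\ge1$ and $t\ge1$, the random variable $\mathcal{E}(g_t)-\inf_{w\in\mathcal{F}}\mathcal{E}(w)$ is integrable and $$\mathbb{E}\Big[\mathcal{E}(g_t)-\inf_{w\in\mathcal{F}}\mathcal{E}(w)\Big]\le C\Big(m^{-\frac12}t^{\frac1{4\beta+2}}\log t+t^{-\frac{\min(2\beta,1)}{2\beta+1}}\log t+t^{-\frac{\beta}{2\beta+1}}\Big).$$ In particular,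 for one pass, $t^*=m$, and all $m\ge2$, $$\mathbb{E}\Big[\mathcal{E}(g_{t^*})-\inf_{w\in\mathcal{F}}\mathcal{E}(w)\Big]\le C\,m^{-\frac{\beta}{2\beta+1}}\log m .$$ -/

import Mathlib

open MeasureTheory ProbabilityTheory

universe u v

namespace SGM

noncomputable section

/-- The expected risk `𝓔(f) = ∫ V(y, f(x)) dρ` of a function `f : X → ℝ`. -/
def expectedRisk {X : Type u} [MeasurableSpace X] {Y : Set ℝ}
    (ρ : Measure (X × Y)) (V : ℝ → ℝ → ℝ) (f : X → ℝ) : ℝ :=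
  ∫ p, V (p.2 : ℝ) (f p.1) ∂ρ

/-- The risk `𝓔(w) = 𝓔(f_w)` of a parameter `w`, where `f_w(x) = ⟪w, Φ(x)⟫`. -/
def risk {X : Type u} [MeasurableSpace X] {Y : Set ℝ}
    {F : Type v} [NormedAddCommGroup F] [InnerProductSpace ℝ F]
    (ρ : Measure (X × Y)) (V : ℝ → ℝ → ℝ) (Φ : X → F) (w : F) : ℝ :=
  expectedRisk ρ V (fun x => inner ℝ w (Φ x))

/-- The left-hand derivative `V'_-(y, a)` of `V(y, ·)` at `a`. -/
def leftDeriv (V : ℝ → ℝ → ℝ) (y a : ℝ) : ℝ :=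
  derivWithin (V y) (Set.Iio a) a

/-- The boundedness assumption: `V(y, ·)` is convex for `y ∈ Y`, and `κ`, `v₀`, `a₀` are upper
bounds of `‖Φ(x)‖`, of `V(y, 0)` and of `|V'_-(y, a)|` over `x ∈ X`, `y ∈ Y`, `a ∈ ℝ`
(the suprema are allowed values of `κ` and `v₀`). -/
structure IsBounded {X : Type u} {F : Type v} [NormedAddCommGroup F]
    (Y : Set ℝ) (V : ℝ → ℝ → ℝ) (Φ : X → F) (κ v₀ a₀ : ℝ) : Prop where
  norm_feature_le : ∀ x, ‖Φ x‖ ≤ κ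
  convex : ∀ y ∈ Y, ConvexOn ℝ Set.univ (V y)
  loss_zero_le : ∀ y ∈ Y, V y 0 ≤ v₀
  leftDeriv_le : ∀ y ∈ Y, ∀ a, |leftDeriv V y a| ≤ a₀

/-- The approximation error
`𝓓(l) = inf_w {𝓔(w) + (l/2) ‖w‖²} - inf_w 𝓔(w)`. -/
def approxError {X : Type u} [MeasurableSpace X] {Y : Set ℝ}
    {F : Type v} [NormedAddCommGroup F] [InnerProductSpace ℝ F]
    (ρ : Measure (X × Y)) (V : ℝ → ℝ → ℝ) (Φ : X → F) (l : ℝ) : ℝ :=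
  (⨅ w : F, (risk ρ V Φ w + l / 2 * ‖w‖ ^ 2)) - ⨅ w : F, risk ρ V Φ w

/-- The iterates `w_t`, `t ≥ 1`, of the stochastic gradient method on the sample `z`, with
step-sizes `η` and index sequence `j` (the index `j t` is used in the step from `w_t` to
`w_{t+1}`): `w_1 = 0` and
`w_{t+1} = w_t - η_t V'_-(y_{j_t}, ⟪w_t, Φ(x_{j_t})⟫) Φ(x_{j_t})`.
The value at `t = 0` is a placeholder. -/
def iterate {X : Type u} {Y : Set ℝ}
    {F : Type v} [NormedAddCommGroup F] [InnerProductSpace ℝ F] {m : ℕ}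
    (V : ℝ → ℝ → ℝ) (Φ : X → F) (η : ℕ → ℝ) (z : Fin m → X × Y) (j : ℕ → Fin m) : ℕ → F
  | 0 => 0
  | 1 => 0
  | t + 2 =>
    iterate V Φ η z j (t + 1) -
      (η (t + 1) * leftDeriv V ((z (j (t + 1))).2 : ℝ)
        (inner ℝ (iterate V Φ η z j (t + 1)) (Φ (z (j (t + 1))).1))) • Φ (z (j (t + 1))).1

/-- The weighted averages `(∑_{k=1}^t η_k w_k) / (∑_{k=1}^t η_k)` of the iterates. -/
def averagedIterate {X : Type u} {Y : Set ℝ}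
    {F : Type v} [NormedAddCommGroup F] [InnerProductSpace ℝ F] {m : ℕ}
    (V : ℝ → ℝ → ℝ) (Φ : X → F) (η : ℕ → ℝ) (z : Fin m → X × Y) (j : ℕ → Fin m) (t : ℕ) : F :=
  (∑ k ∈ Finset.Icc 1 t, η k)⁻¹ • ∑ k ∈ Finset.Icc 1 t, η k • iterate V Φ η z j k

/-- The joint law of the sample and of the index sequence: the points `z_1, …, z_m` are
independent with law `ρ`, and, independently of the sample, the indices `j_t` are independent
and uniformly distributed on the `m` positions. -/
def law {X : Type u} [MeasurableSpace X] {Y : Set ℝ} (ρ : Measure (X × Y)) (m : ℕ) :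
    Measure ((Fin m → X × Y) × (ℕ → Fin m)) :=
  (Measure.pi fun _ : Fin m => ρ).prod
    (Measure.infinitePi fun _ : ℕ => uniformOn (Set.univ : Set (Fin m)))

/-- The excess risk `𝓔(w) - inf_{w'} 𝓔(w')`. -/
def excessRisk {X : Type u} [MeasurableSpace X] {Y : Set ℝ}
    {F : Type v} [NormedAddCommGroup F] [InnerProductSpace ℝ F]
    (ρ : Measure (X × Y)) (V : ℝ → ℝ → ℝ) (Φ : X → F) (w : F) : ℝ :=
  risk ρ V Φ w - ⨅ w' : F, risk ρ V Φ w'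

end

end SGM

/-! Write H_t for the sum of the first t step-sizes. The expected excess risk is controlled by an
optimization, an approximation and a generalization error.

Optimization, for a fixed sample: the left derivative is a subgradient, so expanding ‖w_{k+1} - v‖²
gives a descent inequality for every comparator v. The iterate w_k uses only indices before k;
averaging over j_k therefore turns the loss at the drawn point into the empirical risk. Telescoping
against a fixed u (`IsBounded.weighted_average_le`) bounds the weighted average of the expected
empirical risks by the empirical risk of u, plus ‖u‖² / (2 H_t), plus a multiple of ∑ η² / H_t.
Jensen transfers this to the averaged iterate. For the last iterate, telescoping from s with v = w_s
controls every suffix, and `last_le_weighted_average` converts this into the extra cost `tailSum`.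

Approximation: u does not depend on the sample, so integrating over the sample replaces its
empirical risk by its risk. The infimum over u is then the regularized risk with λ = 1 / H_t, which
produces 𝓓(1 / H_t).

Generalization: the descent inequality with v = 0 confines all iterates to a ball of radius O(√H_t),
whatever the sample and the indices. Symmetrization (`integral_iSup_deviation_le`) and contraction
(`sum_iSup_contraction`) bound the uniform deviation over this ball by O(√(H_t / m)).

For η_t = t^(-θ) with θ = 2β / (2β + 1), H_t is of order t^(1 / (2β + 1)). This θ balances
approximation and generalization at t = m: both are then of order m^(-β / (2β + 1)). -/

namespace SGM

/-! ### From weighted averages to the last term -/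

open Finset in
lemma sum_Icc_eq_add_sum_Icc_succ {f : ℕ → ℝ} {s t : ℕ} (h : s ≤ t) :
    ∑ i ∈ Icc s t, f i = f s + ∑ i ∈ Icc (s + 1) t, f i := by
  rw [← Finset.Ico_add_one_right_eq_Icc, ← Finset.Ico_add_one_right_eq_Icc,
    Finset.sum_eq_sum_Ico_succ_bot (by omega)]

open Finset in
/-- Comparison of the last term of a sequence with its weighted average, given control of the
weighted suffix averages relative to their first term. -/
lemma last_le_weighted_average {η e : ℕ → ℝ} {B : ℝ} {t : ℕ} (hη : ∀ k, 1 ≤ k → 0 < η k)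
    (ht : 1 ≤ t)
    (h : ∀ s, 1 ≤ s → s ≤ t →
      ∑ i ∈ Icc s t, η i * (e i - e s) ≤ B * ∑ i ∈ Icc s t, η i ^ 2) :
    e t ≤ (∑ i ∈ Icc 1 t, η i * e i) / (∑ i ∈ Icc 1 t, η i)
      + B * ∑ s ∈ Ico 1 t, η s * (∑ i ∈ Icc s t, η i ^ 2) /
          ((∑ i ∈ Icc s t, η i) * ∑ i ∈ Icc (s + 1) t, η i) := by
  have hpos : ∀ s, 1 ≤ s → s ≤ t → 0 < ∑ i ∈ Icc s t, η i := fun s hs hst =>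
    sum_pos (fun i hi => hη i (hs.trans (mem_Icc.1 hi).1)) ⟨s, by simp [hst]⟩
  -- The start n of the averaged suffix moves from 1 to t; at n = t the average is `e t` itself.
  have key : ∀ n, 1 ≤ n → n ≤ t →
      (∑ i ∈ Icc n t, η i * e i) / (∑ i ∈ Icc n t, η i) ≤
      (∑ i ∈ Icc 1 t, η i * e i) / (∑ i ∈ Icc 1 t, η i)
      + B * ∑ s ∈ Ico 1 n, η s * (∑ i ∈ Icc s t, η i ^ 2) /
          ((∑ i ∈ Icc s t, η i) * ∑ i ∈ Icc (s + 1) t, η i) := by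
    intro n hn
    induction n, hn using Nat.le_induction with
    | base => intro _; simp
    | succ n hn ih =>
      intro hnt
      have ih := ih (by omega)
      rw [sum_Ico_succ_top hn, mul_add, ← add_assoc]
      refine le_trans ?_ (add_le_add_left ih _)
      have h1 := h n hn (by omega)
      have hH := hpos n hn (by omega)
      have hH' := hpos (n + 1) (by omega) hnt
      have e1 := sum_Icc_eq_add_sum_Icc_succ (f := η) (show n ≤ t by omega)
      have e2 := sum_Icc_eq_add_sum_Icc_succ (f := fun i => η i * e i) (show n ≤ t by omega)
      simp only [mul_sub, sum_sub_distrib, ← sum_mul] at h1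
      generalize ∑ i ∈ Icc n t, η i ^ 2 = Q at *
      generalize ∑ i ∈ Icc n t, η i = H at *
      generalize ∑ i ∈ Icc (n + 1) t, η i = H' at *
      generalize ∑ i ∈ Icc n t, η i * e i = A at *
      generalize ∑ i ∈ Icc (n + 1) t, η i * e i = A' at *
      have hn0 := hη n hn
      have : A / H + B * (η n * Q / (H * H')) = (A * H' + B * η n * Q) / (H * H') := by
        field_simp
      rw [this, div_le_div_iff₀ hH' (by positivity)]
      have h2 := mul_le_mul_of_nonneg_left h1 hn0.le
      -- Removing the first term changes the average through A' H - A H' = η_n (A - e_n H), and A -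
      -- e_n H is the left side of `h` at n.
      have : A' * H ≤ A * H' + B * η n * Q := by
        have e3 : A' = A - η n * e n := by linarith
        have e4 : H' = H - η n := by linarith
        rw [e3, e4]; nlinarith
      nlinarith
  have := key t ht le_rfl
  simpa [(hη t ht).ne'] using this

/-! ### Sums of powers for polynomial step-sizes -/

section

open Finset Real

lemma sum_inv_Icc_le (t : ℕ) : ∑ i ∈ Icc 1 t, ((i : ℝ))⁻¹ ≤ 1 + log t := by
  have := harmonic_le_one_add_log t
  rw [harmonic_eq_sum_Icc] at this
  push_cast at this
  exact this

/-- Bernoulli's inequality for the concave power 1 - θ gives (1 - θ) (n + 1)^(-θ) ≤ (n + 1)^(1 - θ)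
- n^(1 - θ), which telescopes. -/
lemma sum_rpow_neg_le {θ : ℝ} (h0 : 0 ≤ θ) (h1 : θ < 1) (t : ℕ) :
    ∑ i ∈ Icc 1 t, (i : ℝ) ^ (-θ) ≤ (t : ℝ) ^ (1 - θ) / (1 - θ) := by
  have hp : 0 < 1 - θ := by linarith
  rw [le_div_iff₀ hp]
  induction t with
  | zero => simp [hp.ne']
  | succ n ih =>
    rw [sum_Icc_succ_top (by omega), add_mul]
    refine (add_le_add_left ih _).trans ?_
    have hn : (0 : ℝ) < (n + 1 : ℕ) := by positivity
    have hb := rpow_one_add_le_one_add_mul_self (s := -((n + 1 : ℕ) : ℝ)⁻¹)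
      (by rw [neg_le_neg_iff]; exact inv_le_one_of_one_le₀ (by push_cast; linarith [Nat.cast_nonneg (α := ℝ) n]))
      hp.le (by linarith)
    have e1 : 1 + -((n + 1 : ℕ) : ℝ)⁻¹ = n / (n + 1 : ℕ) := by
      field_simp; push_cast; ring
    rw [e1, div_rpow (by positivity) (by positivity), div_le_iff₀ (by positivity)] at hb
    have e2 : ((n + 1 : ℕ) : ℝ) ^ (-θ) = ((n + 1 : ℕ) : ℝ) ^ (1 - θ) * ((n + 1 : ℕ) : ℝ)⁻¹ := by
      rw [← rpow_neg_one, ← rpow_add hn]; congr 1; ring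
    rw [e2]
    linarith

lemma mul_rpow_neg_le_sum {θ : ℝ} (h0 : 0 ≤ θ) {s t : ℕ} (hs : 1 ≤ s) (hst : s ≤ t + 1) :
    ((t : ℝ) + 1 - s) * (t : ℝ) ^ (-θ) ≤ ∑ i ∈ Icc s t, (i : ℝ) ^ (-θ) := by
  have : ((t : ℝ) + 1 - s) = (Icc s t).card := by
    rw [Nat.card_Icc, Nat.cast_sub hst]; push_cast; ring
  rw [this, ← nsmul_eq_mul]
  refine card_nsmul_le_sum _ _ _ fun i hi => ?_
  rw [mem_Icc] at hi
  have : (0 : ℝ) < i := by exact_mod_cast hs.trans hi.1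
  exact rpow_le_rpow_of_nonpos this (by exact_mod_cast hi.2) (by linarith)

lemma rpow_one_sub_le_sum {θ : ℝ} (h0 : 0 ≤ θ) {t : ℕ} (ht : 1 ≤ t) :
    (t : ℝ) ^ (1 - θ) ≤ ∑ i ∈ Icc 1 t, (i : ℝ) ^ (-θ) := by
  have h := mul_rpow_neg_le_sum h0 le_rfl (show 1 ≤ t + 1 by omega)
  have ht' : (0 : ℝ) < t := by exact_mod_cast ht
  rw [sub_eq_add_neg, rpow_add ht', rpow_one]
  simpa using h

/-- Splitting i^(-2θ) = i^(1 - 2θ) · i⁻¹ and bounding the first factor by its largest possible value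
treats θ below, at and above 1/2 together, at the price of a logarithm. -/
lemma sum_rpow_neg_sq_le (θ : ℝ) (t : ℕ) :
    ∑ i ∈ Icc 1 t, ((i : ℝ) ^ (-θ)) ^ 2 ≤ (t : ℝ) ^ (max 0 (1 - 2 * θ)) * (1 + log t) := by
  refine le_trans ?_ (mul_le_mul_of_nonneg_left (sum_inv_Icc_le t) (by positivity))
  rw [mul_sum]
  refine sum_le_sum fun i hi => ?_
  rw [mem_Icc] at hi
  have hi0 : (0 : ℝ) < i := by exact_mod_cast hi.1
  have hi1 : (1 : ℝ) ≤ i := by exact_mod_cast hi.1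
  rw [← rpow_natCast, ← rpow_mul hi0.le]
  have : (i : ℝ) ^ (-θ * ((2 : ℕ) : ℝ)) = (i : ℝ) ^ (1 - 2 * θ) * (i : ℝ)⁻¹ := by
    rw [← rpow_neg_one, ← rpow_add hi0]; congr 1; push_cast; ring
  rw [this]
  refine mul_le_mul_of_nonneg_right ?_ (by positivity)
  refine (rpow_le_rpow_of_exponent_le hi1 (le_max_right 0 _)).trans ?_
  exact rpow_le_rpow hi0.le (by exact_mod_cast hi.2) (le_max_left _ _)

lemma sum_sq_mul_rpow_le (θ : ℝ) {t : ℕ} (ht : 1 ≤ t) :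
    (∑ i ∈ Icc 1 t, ((i : ℝ) ^ (-θ)) ^ 2) * (t : ℝ) ^ (-(1 - θ)) ≤
      (t : ℝ) ^ (-(min θ (1 - θ))) * (1 + log t) := by
  have ht' : (0 : ℝ) < t := by exact_mod_cast ht
  refine (mul_le_mul_of_nonneg_right (sum_rpow_neg_sq_le θ t) (by positivity)).trans_eq ?_
  rw [mul_right_comm, ← rpow_add ht']
  congr 2
  rcases le_total θ (1 - θ) with h | h
  · rw [min_eq_left h, max_eq_right (by linarith)]; ring
  · rw [min_eq_right h, max_eq_left (by linarith)]; ring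

/-- If s ≤ t/2, both suffix sums in the denominator are at least t^(1 - θ) / 2, which gives the
first summand. If s > t/2, all steps in the suffix are comparable to t^(-θ), which gives the second.
-/
lemma tail_term_le {θ : ℝ} (h0 : 0 ≤ θ) (h1 : θ ≤ 2 / 3) {s t : ℕ} (hs : 1 ≤ s) (hst : s < t) :
    (s : ℝ) ^ (-θ) * (∑ i ∈ Icc s t, ((i : ℝ) ^ (-θ)) ^ 2) /
      ((∑ i ∈ Icc s t, (i : ℝ) ^ (-θ)) * ∑ i ∈ Icc (s + 1) t, (i : ℝ) ^ (-θ)) ≤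
    4 * (∑ i ∈ Icc 1 t, ((i : ℝ) ^ (-θ)) ^ 2) * (t : ℝ) ^ (-(2 * (1 - θ))) * (s : ℝ) ^ (-θ)
      + 4 * (t : ℝ) ^ (-θ) * ((t - s : ℕ) : ℝ)⁻¹ := by
  have hs0 : (0 : ℝ) < s := by exact_mod_cast hs
  have hst' : (s : ℝ) < t := by exact_mod_cast hst
  have ht0 : (0 : ℝ) < t := hs0.trans hst'
  have hts : (0 : ℝ) < (t : ℝ) - s := by linarith
  have hH := mul_rpow_neg_le_sum h0 hs (show s ≤ t + 1 by omega)
  have hH' := mul_rpow_neg_le_sum h0 (show 1 ≤ s + 1 by omega) (show s + 1 ≤ t + 1 by omega)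
  push_cast at hH'
  have e1 : (t : ℝ) + 1 - (s + 1) = t - s := by ring
  rw [e1] at hH'
  rw [Nat.cast_sub hst.le]
  set p := (t : ℝ) ^ (-θ) with hp
  have hp0 : 0 < p := by positivity
  rcases le_or_gt (2 * s) t with h | h
  · have h2 : (2 * s : ℝ) ≤ t := by exact_mod_cast h
    refine le_trans ?_ (le_add_of_nonneg_right (by positivity))
    have hQ : ∑ i ∈ Icc s t, ((i : ℝ) ^ (-θ)) ^ 2 ≤ ∑ i ∈ Icc 1 t, ((i : ℝ) ^ (-θ)) ^ 2 :=
      sum_le_sum_of_subset_of_nonneg (Icc_subset_Icc_left hs) fun _ _ _ => by positivity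
    have e2 : (t : ℝ) ^ (-(2 * (1 - θ))) = ((t * p) ^ 2)⁻¹ := by
      rw [hp, rpow_neg ht0.le, mul_comm 2, rpow_mul ht0.le, sub_eq_add_neg, rpow_add ht0, rpow_one]
      norm_num
    rw [e2]
    have hHa : t * p / 2 ≤ ∑ i ∈ Icc s t, (i : ℝ) ^ (-θ) := le_trans (by nlinarith) hH
    have hHb : t * p / 2 ≤ ∑ i ∈ Icc (s + 1) t, (i : ℝ) ^ (-θ) := le_trans (by nlinarith) hH'
    calc _ ≤ (s : ℝ) ^ (-θ) * (∑ i ∈ Icc 1 t, ((i : ℝ) ^ (-θ)) ^ 2) /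
          ((t * p / 2) * (t * p / 2)) := by gcongr
      _ = _ := by field_simp; ring
  · have h2 : (t : ℝ) / 2 ≤ s := by
      have : (t : ℝ) ≤ 2 * s := by exact_mod_cast h.le
      linarith
    refine le_trans ?_ (le_add_of_nonneg_left (by positivity))
    have hQ : ∑ i ∈ Icc s t, ((i : ℝ) ^ (-θ)) ^ 2 ≤ ((t : ℝ) + 1 - s) * ((s : ℝ) ^ (-θ)) ^ 2 := by
      have : ((t : ℝ) + 1 - s) = (Icc s t).card := by
        rw [Nat.card_Icc, Nat.cast_sub (by omega)]; push_cast; ring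
      rw [this, ← nsmul_eq_mul]
      refine sum_le_card_nsmul _ _ _ fun i hi => ?_
      rw [mem_Icc] at hi
      have := rpow_le_rpow_of_nonpos hs0 (show (s : ℝ) ≤ i by exact_mod_cast hi.1)
        (show -θ ≤ 0 by linarith)
      gcongr
    have hs3 : ((s : ℝ) ^ (-θ)) ^ 3 ≤ 4 * p ^ 3 := by
      have h3 : (s : ℝ) ^ (-θ) ≤ 2 ^ θ * p := by
        calc (s : ℝ) ^ (-θ) ≤ (t / 2 : ℝ) ^ (-θ) :=
              rpow_le_rpow_of_nonpos (by positivity) h2 (by linarith)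
          _ = 2 ^ θ * p := by
            rw [div_rpow ht0.le (by norm_num), rpow_neg (by norm_num : (0 : ℝ) ≤ 2)]
            field_simp
            rfl
      -- The condition θ ≤ 2/3 enters here, as 2^(3θ) ≤ 4.
      have h4 : ((2 : ℝ) ^ θ) ^ 3 ≤ 4 := by
        rw [← rpow_natCast, ← rpow_mul (by norm_num)]
        calc (2 : ℝ) ^ (θ * (3 : ℕ)) ≤ 2 ^ (2 : ℝ) :=
              rpow_le_rpow_of_exponent_le (by norm_num) (by push_cast; linarith)
          _ = 4 := by norm_num
      calc ((s : ℝ) ^ (-θ)) ^ 3 ≤ (2 ^ θ * p) ^ 3 := by gcongr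
        _ = (2 ^ θ) ^ 3 * p ^ 3 := by ring
        _ ≤ _ := by gcongr
    have hts1 : (0 : ℝ) < (t : ℝ) + 1 - s := by linarith
    calc _ ≤ (s : ℝ) ^ (-θ) * (((t : ℝ) + 1 - s) * ((s : ℝ) ^ (-θ)) ^ 2) /
          ((((t : ℝ) + 1 - s) * p) * ((t - s) * p)) := by gcongr
      _ = ((s : ℝ) ^ (-θ)) ^ 3 / (p ^ 2 * (t - s)) := by field_simp
      _ ≤ 4 * p ^ 3 / (p ^ 2 * (t - s)) := by gcongr
      _ = _ := by field_simp

lemma tail_le {θ : ℝ} (h0 : 0 ≤ θ) (h1 : θ ≤ 2 / 3) {t : ℕ} (ht : 1 ≤ t) :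
    ∑ s ∈ Ico 1 t, (s : ℝ) ^ (-θ) * (∑ i ∈ Icc s t, ((i : ℝ) ^ (-θ)) ^ 2) /
      ((∑ i ∈ Icc s t, (i : ℝ) ^ (-θ)) * ∑ i ∈ Icc (s + 1) t, (i : ℝ) ^ (-θ)) ≤
    16 * ((t : ℝ) ^ (-(min θ (1 - θ))) * (1 + log t)) := by
  have ht0 : (0 : ℝ) < t := by exact_mod_cast ht
  have ht1 : (1 : ℝ) ≤ t := by exact_mod_cast ht
  have hlog : 0 ≤ log t := log_nonneg ht1
  refine (sum_le_sum fun s hs => tail_term_le h0 h1 (mem_Ico.1 hs).1 (mem_Ico.1 hs).2).trans ?_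
  rw [sum_add_distrib, ← mul_sum, ← mul_sum]
  -- The factor 3 bounds 1 / (1 - θ). Early indices then contribute 4 · 3 = 12 and late ones,
  -- through a harmonic sum, 4: together 16.
  have hA : ∑ s ∈ Ico 1 t, (s : ℝ) ^ (-θ) ≤ 3 * (t : ℝ) ^ (1 - θ) := by
    calc ∑ s ∈ Ico 1 t, (s : ℝ) ^ (-θ) ≤ ∑ s ∈ Icc 1 t, (s : ℝ) ^ (-θ) :=
          sum_le_sum_of_subset_of_nonneg Ico_subset_Icc_self fun _ _ _ => by positivity
      _ ≤ (t : ℝ) ^ (1 - θ) / (1 - θ) := sum_rpow_neg_le h0 (by linarith) t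
      _ ≤ _ := by
        rw [div_le_iff₀ (by linarith)]
        have : 0 < (t : ℝ) ^ (1 - θ) := by positivity
        nlinarith
  have hB : ∑ s ∈ Ico 1 t, ((t - s : ℕ) : ℝ)⁻¹ ≤ 1 + log t := by
    refine le_trans ?_ (sum_inv_Icc_le t)
    have := sum_Ico_reflect (fun i => ((i : ℕ) : ℝ)⁻¹) 1 (show t ≤ t + 1 by omega)
    have e : t + 1 - t = 1 := by omega
    rw [e, Nat.add_sub_cancel] at this
    rw [this]
    exact sum_le_sum_of_subset_of_nonneg Ico_subset_Icc_self fun _ _ _ => by positivity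
  have hQ := sum_sq_mul_rpow_le θ ht
  have hp : (t : ℝ) ^ (-θ) ≤ (t : ℝ) ^ (-(min θ (1 - θ))) :=
    rpow_le_rpow_of_exponent_le ht1 (neg_le_neg (min_le_left _ _))
  have e2 : (t : ℝ) ^ (-(2 * (1 - θ))) * (t : ℝ) ^ (1 - θ) = (t : ℝ) ^ (-(1 - θ)) := by
    rw [← rpow_add ht0]; congr 1; ring
  calc _ ≤ 4 * (∑ i ∈ Icc 1 t, ((i : ℝ) ^ (-θ)) ^ 2) * (t : ℝ) ^ (-(2 * (1 - θ))) *
          (3 * (t : ℝ) ^ (1 - θ)) + 4 * (t : ℝ) ^ (-(min θ (1 - θ))) * (1 + log t) := by gcongr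
    _ = 12 * ((∑ i ∈ Icc 1 t, ((i : ℝ) ^ (-θ)) ^ 2) * (t : ℝ) ^ (-(1 - θ)))
          + 4 * (t : ℝ) ^ (-(min θ (1 - θ))) * (1 + log t) := by rw [← e2]; ring
    _ ≤ _ := by linarith

end

/-! ### Rademacher averages and contraction -/

/-- The real sign attached to a Boolean. -/
def sign (b : Bool) : ℝ := if b then 1 else -1

lemma abs_sign (b : Bool) : |sign b| = 1 := by cases b <;> simp [sign]

lemma sum_fin_succ_bool {M : Type*} [AddCommMonoid M] {m : ℕ} (f : (Fin (m + 1) → Bool) → M) :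
    ∑ σ, f σ = ∑ σ : Fin m → Bool, (f (Fin.cons true σ) + f (Fin.cons false σ)) := by
  rw [← (Fin.consEquiv fun _ => Bool).sum_comp, Fintype.sum_prod_type, Fintype.sum_bool,
    ← Finset.sum_add_distrib]
  rfl

/-- Comparison of suprema of signed sums (Ledoux--Talagrand contraction). -/
lemma sum_iSup_contraction {ι : Type*} [Nonempty ι] {m : ℕ} (h : ι → ℝ) (f a : Fin m → ι → ℝ)
    {K : ℝ} (hh : ∀ x, |h x| ≤ K) (hf : ∀ i x, |f i x| ≤ K) (ha : ∀ i x, |a i x| ≤ K)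
    (hfa : ∀ i x y, |f i x - f i y| ≤ |a i x - a i y|) :
    ∑ σ : Fin m → Bool, ⨆ x, (h x + ∑ i, sign (σ i) * f i x) ≤
      ∑ σ : Fin m → Bool, ⨆ x, (h x + ∑ i, sign (σ i) * a i x) := by
  induction m generalizing h K with
  | zero => simp
  | succ m ih =>
    have hK : 0 ≤ K := (abs_nonneg _).trans (hh (Classical.arbitrary ι))
    have hsg : ∀ b x, |sign b * f 0 x| ≤ K := fun b x => by
      rw [abs_mul, abs_sign, one_mul]; exact hf 0 x
    -- The first signed term is absorbed into `h`, so that the induction hypothesis replaces all the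
    -- others. This doubles the bound K, which serves only to keep the suprema finite.
    have step : ∀ b, ∑ σ : Fin m → Bool,
        ⨆ x, ((h x + sign b * f 0 x) + ∑ i, sign (σ i) * f i.succ x) ≤
        ∑ σ : Fin m → Bool,
        ⨆ x, ((h x + sign b * f 0 x) + ∑ i, sign (σ i) * a i.succ x) := fun b =>
      ih (fun x => h x + sign b * f 0 x) (fun i => f i.succ) (fun i => a i.succ) (K := 2 * K)
        (fun x => (abs_add_le _ _).trans (by linarith [hh x, hsg b x]))
        (fun i x => (hf _ x).trans (by linarith)) (fun i x => (ha _ x).trans (by linarith))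
        (fun i => hfa _)
    rw [sum_fin_succ_bool, sum_fin_succ_bool]
    simp only [Fin.sum_univ_succ, Fin.cons_zero, Fin.cons_succ, ← add_assoc]
    rw [Finset.sum_add_distrib]
    refine (add_le_add (step true) (step false)).trans ?_
    rw [← Finset.sum_add_distrib]
    refine Finset.sum_le_sum fun σ _ => ?_
    have hbd : ∀ b, BddAbove (Set.range fun x =>
        h x + sign b * a 0 x + ∑ i, sign (σ i) * a i.succ x) := fun b => by
      refine ⟨K + K + ∑ _i : Fin m, K, ?_⟩
      rintro _ ⟨x, rfl⟩
      have h1 := (le_abs_self _).trans (hh x)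
      have h2 : ∀ (c : Bool) (i : Fin (m + 1)), sign c * a i x ≤ K := fun c i => by
        refine (le_abs_self _).trans ?_
        rw [abs_mul, abs_sign, one_mul]; exact ha _ x
      exact add_le_add (add_le_add h1 (h2 _ _)) (Finset.sum_le_sum fun i _ => h2 _ _)
    have main : ∀ x y, (h x + sign true * f 0 x + ∑ i, sign (σ i) * a i.succ x) +
        (h y + sign false * f 0 y + ∑ i, sign (σ i) * a i.succ y) ≤
        (⨆ x, (h x + sign true * a 0 x + ∑ i, sign (σ i) * a i.succ x)) +
        ⨆ x, (h x + sign false * a 0 x + ∑ i, sign (σ i) * a i.succ x) := by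
      intro x y
      have h1 := (le_abs_self _).trans (hfa 0 x y)
      have xt := le_ciSup (hbd true) x
      have xf := le_ciSup (hbd false) x
      have yt := le_ciSup (hbd true) y
      have yf := le_ciSup (hbd false) y
      simp only [sign, if_true, Bool.false_eq_true, if_false] at *
      -- The larger value of `a 0` is paired with the positive sign: x and y keep their roles in the
      -- first case and exchange them in the second.
      rcases le_total (a 0 y) (a 0 x) with hxy | hxy
      · rw [abs_of_nonneg (by linarith)] at h1; linarith
      · rw [abs_of_nonpos (by linarith)] at h1; linarith
    rw [← le_sub_iff_add_le]
    refine ciSup_le fun x => ?_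
    rw [le_sub_iff_add_le, ← le_sub_iff_add_le']
    refine ciSup_le fun y => ?_
    rw [le_sub_iff_add_le']
    exact main x y

/-- Summing over one sign is the parallelogram law; the free vector `v` collects the terms whose
signs are already chosen. -/
lemma sum_sign_norm_sq {F : Type*} [NormedAddCommGroup F] [InnerProductSpace ℝ F] {m : ℕ}
    (v : F) (x : Fin m → F) :
    ∑ σ : Fin m → Bool, ‖v + ∑ i, sign (σ i) • x i‖ ^ 2 = 2 ^ m * (‖v‖ ^ 2 + ∑ i, ‖x i‖ ^ 2) := by
  induction m generalizing v with
  | zero => simp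
  | succ m ih =>
    rw [sum_fin_succ_bool, Finset.sum_add_distrib]
    simp only [Fin.sum_univ_succ, Fin.cons_zero, Fin.cons_succ, ← add_assoc, ih]
    have := parallelogram_law_with_norm ℝ v (x 0)
    simp only [sign, if_true, Bool.false_eq_true, if_false, one_smul, neg_smul, ← sub_eq_add_neg]
    rw [pow_succ]
    linear_combination 2 ^ m * this

/-- Cauchy–Schwarz over the 2^m sign patterns reduces this to the second moment. -/
lemma sum_sign_norm_le {F : Type*} [NormedAddCommGroup F] [InnerProductSpace ℝ F] {m : ℕ}
    (x : Fin m → F) {κ : ℝ} (hκ : 0 ≤ κ) (hx : ∀ i, ‖x i‖ ≤ κ) :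
    ∑ σ : Fin m → Bool, ‖∑ i, sign (σ i) • x i‖ ≤ 2 ^ m * (κ * √m) := by
  have h1 := sum_sign_norm_sq 0 x
  simp only [zero_add, norm_zero] at h1
  have hcard : (Finset.univ : Finset (Fin m → Bool)).card = 2 ^ m := by simp
  have h2 := sq_sum_le_card_mul_sum_sq (s := (Finset.univ : Finset (Fin m → Bool)))
    (f := fun σ => ‖∑ i, sign (σ i) • x i‖)
  rw [h1, hcard] at h2
  have h3 : ∑ i, ‖x i‖ ^ 2 ≤ m * κ ^ 2 := by
    calc ∑ i, ‖x i‖ ^ 2 ≤ ∑ _i : Fin m, κ ^ 2 :=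
          Finset.sum_le_sum fun i _ => pow_le_pow_left₀ (norm_nonneg _) (hx i) 2
      _ = _ := by simp
  refine abs_le_of_sq_le_sq' ?_ (by positivity) |>.2
  have h4 : (κ * √m) ^ 2 = m * κ ^ 2 := by
    rw [mul_pow, Real.sq_sqrt (by positivity)]; ring
  rw [mul_pow, h4]
  push_cast at h2
  refine h2.trans ?_
  have : (0 : ℝ) < 2 ^ m := by positivity
  nlinarith [mul_le_mul_of_nonneg_left h3 (mul_pos this this).le]

/-- Bound on the empirical Rademacher average of the losses of linear functions on a ball. -/
lemma sum_iSup_sign_le {F : Type*} [NormedAddCommGroup F] [InnerProductSpace ℝ F] {m : ℕ}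
    {ι : Type*} [Nonempty ι] (d : ι → F) {R κ a₀ K : ℝ} (hR : 0 ≤ R) (hκ : 0 ≤ κ) (ha₀ : 0 ≤ a₀)
    (hd : ∀ n, ‖d n‖ ≤ R) (x : Fin m → F) (hx : ∀ i, ‖x i‖ ≤ κ) (φ : Fin m → ℝ → ℝ)
    (hφ : ∀ i a b, |φ i a - φ i b| ≤ a₀ * |a - b|)
    (hK : ∀ i n, |φ i (inner ℝ (d n) (x i))| ≤ K) :
    ∑ σ : Fin m → Bool, ⨆ n, ∑ i, sign (σ i) * φ i (inner ℝ (d n) (x i)) ≤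
      2 ^ m * (a₀ * κ * R * √m) := by
  have hin : ∀ i n, |inner ℝ (d n) (x i)| ≤ R * κ := fun i n =>
    (abs_real_inner_le_norm _ _).trans (mul_le_mul (hd n) (hx i) (norm_nonneg _) hR)
  have h1 := sum_iSup_contraction (ι := ι) (fun _ => 0)
    (fun i n => φ i (inner ℝ (d n) (x i))) (fun i n => a₀ * inner ℝ (d n) (x i))
    (K := max |K| (a₀ * (R * κ))) (fun _ => by simp)
    (fun i n => (hK i n).trans ((le_abs_self _).trans (le_max_left _ _)))
    (fun i n => by
      rw [abs_mul, abs_of_nonneg ha₀]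
      exact (mul_le_mul_of_nonneg_left (hin i n) ha₀).trans (le_max_right _ _))
    (fun i n k => by
      rw [← mul_sub, abs_mul, abs_of_nonneg ha₀]; exact hφ _ _ _)
  simp only [zero_add] at h1
  refine h1.trans ?_
  -- After contraction the sum is linear in `d n`, so Cauchy–Schwarz removes the supremum.
  have h2 : ∀ σ : Fin m → Bool, ⨆ n, ∑ i, sign (σ i) * (a₀ * inner ℝ (d n) (x i)) ≤
      a₀ * R * ‖∑ i, sign (σ i) • x i‖ := by
    intro σ
    refine ciSup_le fun n => ?_
    have : ∑ i, sign (σ i) * (a₀ * inner ℝ (d n) (x i)) =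
        a₀ * inner ℝ (d n) (∑ i, sign (σ i) • x i) := by
      rw [inner_sum, Finset.mul_sum]
      exact Finset.sum_congr rfl fun i _ => by rw [inner_smul_right]; ring
    rw [this, mul_assoc]
    refine mul_le_mul_of_nonneg_left ?_ ha₀
    exact (real_inner_le_norm _ _).trans (mul_le_mul_of_nonneg_right (hd n) (norm_nonneg _))
  refine (Finset.sum_le_sum fun σ _ => h2 σ).trans ?_
  rw [← Finset.mul_sum]
  refine (mul_le_mul_of_nonneg_left (sum_sign_norm_le x hκ hx) (by positivity)).trans_eq ?_
  ring

/-! ### Symmetrization -/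

lemma bddAbove_range_of_abs_le {ι : Type*} {f : ι → ℝ} {K : ℝ} (h : ∀ i, |f i| ≤ K) :
    BddAbove (Set.range f) :=
  ⟨K, by rintro _ ⟨i, rfl⟩; exact (le_abs_self _).trans (h i)⟩

lemma abs_ciSup_le {ι : Type*} [Nonempty ι] {f : ι → ℝ} {K : ℝ} (h : ∀ i, |f i| ≤ K) :
    |⨆ i, f i| ≤ K := by
  obtain ⟨i⟩ := ‹Nonempty ι›
  rw [abs_le]
  exact ⟨(abs_le.1 (h i)).1.trans (le_ciSup (bddAbove_range_of_abs_le h) i),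
    haveI : Nonempty ι := ⟨i⟩; ciSup_le fun i => (abs_le.1 (h i)).2⟩

/-- A countable index keeps the supremum measurable; later a dense sequence stands in for the whole
ball. -/
lemma integrable_iSup_of_abs_le {α : Type*} [MeasurableSpace α] {μ : Measure α}
    [IsFiniteMeasure μ] {f : ℕ → α → ℝ} {K : ℝ} (hf : ∀ n, Measurable (f n))
    (h : ∀ n x, |f n x| ≤ K) : Integrable (fun x => ⨆ n, f n x) μ :=
  Integrable.of_bound (Measurable.iSup hf).aestronglyMeasurable K
    (Filter.Eventually.of_forall fun x => abs_ciSup_le fun n => h n x)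

lemma sign_not (b : Bool) : sign (!b) = -sign b := by cases b <;> simp [sign]

lemma abs_sum_sign_mul_le {m : ℕ} {f : Fin m → ℝ} {K : ℝ} (h : ∀ i, |f i| ≤ K)
    (σ : Fin m → Bool) : |∑ i, sign (σ i) * f i| ≤ m * K := by
  refine (Finset.abs_sum_le_sum_abs _ _).trans ?_
  calc ∑ i, |sign (σ i) * f i| ≤ ∑ _i : Fin m, K :=
        Finset.sum_le_sum fun i _ => by rw [abs_mul, abs_sign, one_mul]; exact h i
    _ = _ := by simp

/-- Symmetrization: a pointwise bound on the empirical Rademacher averages of a sequence of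
bounded functions controls the expected supremum of the deviations of the empirical means. -/
lemma integral_iSup_deviation_le {Z : Type*} [MeasurableSpace Z] (ρ : Measure Z)
    [IsProbabilityMeasure ρ] {m : ℕ} (l : ℕ → Z → ℝ) {K B : ℝ} (hl : ∀ n, Measurable (l n))
    (hK : ∀ n z, |l n z| ≤ K)
    (hB : ∀ z : Fin m → Z,
      ∑ σ : Fin m → Bool, ⨆ n, ∑ i, sign (σ i) * l n (z i) ≤ 2 ^ m * B) :
    ∫ z, ⨆ n, (m * ∫ p, l n p ∂ρ - ∑ i, l n (z i)) ∂(Measure.pi fun _ : Fin m => ρ) ≤ 2 * B := by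
  set μ := Measure.pi fun _ : Fin m => ρ
  have hK2 : ∀ n p q, |l n p - l n q| ≤ 2 * K := fun n p q =>
    (abs_sub _ _).trans (by linarith [hK n p, hK n q])
  have hb1 : ∀ σ : Fin m → Bool, ∀ n (z z' : Fin m → Z),
      |∑ i, sign (σ i) * (l n (z' i) - l n (z i))| ≤ m * (2 * K) :=
    fun σ n z z' => abs_sum_sign_mul_le (fun i => hK2 n _ _) σ
  have hb2 : ∀ n (z z' : Fin m → Z), |∑ i, (l n (z' i) - l n (z i))| ≤ m * (2 * K) := by
    intro n z z'
    simpa [sign] using hb1 (fun _ => true) n z z'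
  have hm1 : ∀ σ : Fin m → Bool, ∀ n, Measurable fun q : Fin m → Z × Z =>
      ∑ i, sign (σ i) * (l n (q i).2 - l n (q i).1) := fun σ n =>
    Finset.measurable_sum _ fun i _ => measurable_const.mul
      (((hl n).comp (measurable_pi_apply i).snd).sub ((hl n).comp (measurable_pi_apply i).fst))
  have hm2 : ∀ n, Measurable fun q : (Fin m → Z) × (Fin m → Z) =>
      ∑ i, (l n (q.2 i) - l n (q.1 i)) := fun n =>
    Finset.measurable_sum _ fun i _ =>
      (((hl n).comp ((measurable_pi_apply i).comp measurable_snd)).sub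
        ((hl n).comp ((measurable_pi_apply i).comp measurable_fst)))
  have hlint : ∀ n (i : Fin m), Integrable (fun z' : Fin m → Z => l n (z' i)) μ := fun n i =>
    Integrable.of_bound ((hl n).comp (measurable_pi_apply i)).aestronglyMeasurable K
      (Filter.Eventually.of_forall fun z => hK n _)
  -- comparison with a ghost sample
  have hmean : ∀ n (z : Fin m → Z), m * ∫ p, l n p ∂ρ - ∑ i, l n (z i) =
      ∫ z', ∑ i, (l n (z' i) - l n (z i)) ∂μ := by
    intro n z
    rw [integral_finsetSum (f := fun i (z' : Fin m → Z) => l n (z' i) - l n (z i)) _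
      fun i _ => (hlint n i).sub (integrable_const _)]
    have : ∀ i, ∫ z', (l n (z' i) - l n (z i)) ∂μ = ∫ p, l n p ∂ρ - l n (z i) := fun i => by
      rw [integral_sub (hlint n i) (integrable_const _), integral_const,
        integral_comp_eval (μ := fun _ : Fin m => ρ) (hl n).aestronglyMeasurable]
      simp
    simp [this]
  have hD : Integrable (fun q : (Fin m → Z) × (Fin m → Z) =>
      ⨆ n, ∑ i, (l n (q.2 i) - l n (q.1 i))) (μ.prod μ) :=
    integrable_iSup_of_abs_le hm2 fun n q => hb2 n _ _
  have hsec : ∀ z : Fin m → Z, Integrable (fun z' : Fin m → Z =>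
      ⨆ n, ∑ i, (l n (z' i) - l n (z i))) μ := fun z =>
    integrable_iSup_of_abs_le (fun n => (hm2 n).comp measurable_prodMk_left) fun n q => hb2 n _ _
  -- The mean is an integral over the ghost sample, and the supremum of integrals is at most the
  -- integral of the supremum.
  have step1 : ∫ z, ⨆ n, (m * ∫ p, l n p ∂ρ - ∑ i, l n (z i)) ∂μ ≤
      ∫ q, ⨆ n, ∑ i, (l n (q.2 i) - l n (q.1 i)) ∂(μ.prod μ) := by
    rw [integral_prod _ hD]
    refine integral_mono ?_ hD.integral_prod_left fun z => ciSup_le fun n => ?_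
    · refine integrable_iSup_of_abs_le (K := m * (2 * K)) (fun n => ?_) fun n z => ?_
      · exact measurable_const.sub
          (Finset.measurable_sum _ fun i _ => (hl n).comp (measurable_pi_apply i))
      · rw [hmean]
        refine abs_integral_le_integral_abs.trans ?_
        calc _ ≤ ∫ _z' : Fin m → Z, (m * (2 * K) : ℝ) ∂μ :=
              integral_mono (Integrable.of_bound
                ((hm2 n).comp measurable_prodMk_left).abs.aestronglyMeasurable (m * (2 * K))
                (Filter.Eventually.of_forall fun z' => by
                  simpa using hb2 n z z')) (integrable_const _) fun z' => hb2 n z z'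
          _ = _ := by simp
    · rw [hmean]
      refine integral_mono (Integrable.of_bound
                ((hm2 n).comp measurable_prodMk_left).aestronglyMeasurable (m * (2 * K))
                (Filter.Eventually.of_forall fun z' => hb2 n z z')) (hsec z) fun z' => ?_
      exact le_ciSup (bddAbove_range_of_abs_le fun n => hb2 n z z') n
  -- exchangeability of the two samples
  set ν := Measure.pi fun _ : Fin m => ρ.prod ρ
  have step2 : ∀ σ : Fin m → Bool,
      ∫ q, ⨆ n, ∑ i, (l n (q.2 i) - l n (q.1 i)) ∂(μ.prod μ) =
      ∫ q, ⨆ n, ∑ i, sign (σ i) * (l n (q i).2 - l n (q i).1) ∂ν := by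
    intro σ
    rw [← (measurePreserving_arrowProdEquivProdArrow Z Z (Fin m) (fun _ => ρ)
      (fun _ => ρ)).integral_comp' (fun q : (Fin m → Z) × (Fin m → Z) =>
        ⨆ n, ∑ i, (l n (q.2 i) - l n (q.1 i)))]
    -- Exchanging the two points of pair i flips the sign of its difference, without changing the
    -- joint law.
    have hswap : MeasurePreserving (fun (q : Fin m → Z × Z) i =>
        (if σ i then id else Prod.swap) (q i)) ν ν :=
      measurePreserving_pi _ _ fun i => by
        cases σ i
        · simpa using Measure.measurePreserving_swap
        · simpa using MeasurePreserving.id _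
    conv_rhs => rw [← hswap.map_eq]
    rw [integral_map hswap.measurable.aemeasurable
      (Measurable.iSup (hm1 σ)).aestronglyMeasurable]
    refine integral_congr_ae (Filter.Eventually.of_forall fun q => ?_)
    refine congrArg iSup (funext fun n => Finset.sum_congr rfl fun i _ => ?_)
    change l n (q i).2 - l n (q i).1 = _
    cases h : σ i <;> simp [sign, h]
  have hint : ∀ σ : Fin m → Bool, Integrable (fun q : Fin m → Z × Z =>
      ⨆ n, ∑ i, sign (σ i) * (l n (q i).2 - l n (q i).1)) ν := fun σ =>
    integrable_iSup_of_abs_le (hm1 σ) fun n q => hb1 σ n (fun i => (q i).1) (fun i => (q i).2)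
  have step3 : (2 : ℝ) ^ m * ∫ q, ⨆ n, ∑ i, (l n (q.2 i) - l n (q.1 i)) ∂(μ.prod μ) ≤
      2 ^ m * (2 * B) := by
    have e : (2 : ℝ) ^ m * ∫ q, ⨆ n, ∑ i, (l n (q.2 i) - l n (q.1 i)) ∂(μ.prod μ) =
        ∑ σ : Fin m → Bool,
          ∫ q, ⨆ n, ∑ i, sign (σ i) * (l n (q i).2 - l n (q i).1) ∂ν := by
      rw [← Finset.sum_congr rfl fun σ _ => step2 σ]
      simp
    rw [e, ← integral_finsetSum _ fun σ _ => hint σ]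
    calc _ ≤ ∫ _q : Fin m → Z × Z, (2 ^ m * (2 * B) : ℝ) ∂ν := by
          refine integral_mono (integrable_finsetSum _ fun σ _ => hint σ) (integrable_const _)
            fun q => ?_
          have h1 := hB fun i => (q i).2
          have h2 := hB fun i => (q i).1
          -- Negating all signs permutes the patterns, so each of the two samples contributes at
          -- most 2^m B; hence the factor 2.
          have h3 : ∑ σ : Fin m → Bool, ⨆ n, ∑ i, sign (!σ i) * l n (q i).1 =
              ∑ σ : Fin m → Bool, ⨆ n, ∑ i, sign (σ i) * l n (q i).1 :=
            Equiv.sum_comp (Equiv.arrowCongr (Equiv.refl (Fin m)) Equiv.boolNot)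
              (fun σ : Fin m → Bool => ⨆ n, ∑ i, sign (σ i) * l n (q i).1)
          rw [← h3] at h2
          calc _ ≤ ∑ σ : Fin m → Bool, ((⨆ n, ∑ i, sign (σ i) * l n (q i).2) +
                ⨆ n, ∑ i, sign (!σ i) * l n (q i).1) := by
                refine Finset.sum_le_sum fun σ _ => ciSup_le fun n => ?_
                have ea := le_ciSup (bddAbove_range_of_abs_le fun n =>
                  abs_sum_sign_mul_le (fun i => hK n (q i).2) σ) n
                have eb := le_ciSup (bddAbove_range_of_abs_le fun n =>
                  abs_sum_sign_mul_le (fun i => hK n (q i).1) (fun i => !σ i)) n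
                refine le_trans (le_of_eq ?_) (add_le_add ea eb)
                rw [← Finset.sum_add_distrib]
                exact Finset.sum_congr rfl fun i _ => by rw [sign_not]; ring
            _ ≤ _ := by rw [Finset.sum_add_distrib]; linarith
      _ = _ := by simp
  exact step1.trans (le_of_mul_le_mul_left step3 (by positivity))

/-! ### The left derivative of a convex loss -/

/-- The left derivative is a subgradient: it lies between the slopes to the left of `a` and, through
the right derivative, those to the right. -/
lemma leftDeriv_mul_sub_le {V : ℝ → ℝ → ℝ} {y : ℝ} (h : ConvexOn ℝ Set.univ (V y)) (a b : ℝ) :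
    leftDeriv V y a * (b - a) ≤ V y b - V y a := by
  rcases lt_trichotomy b a with hab | rfl | hab
  · have := h.slope_le_leftDeriv_of_mem_interior (Set.mem_univ b) (y := a) (by simp) hab
    rw [slope_def_field, div_le_iff₀ (by linarith)] at this
    unfold leftDeriv
    linarith
  · simp
  · have h1 := h.leftDeriv_le_rightDeriv_of_mem_interior (x := a) (by simp)
    have h2 := h.rightDeriv_le_slope_of_mem_interior (x := a) (by simp) (Set.mem_univ b) hab
    have := h1.trans h2
    rwa [slope_def_field, le_div_iff₀ (by linarith)] at this

lemma tendsto_leftDeriv {V : ℝ → ℝ → ℝ} {y : ℝ} (h : ConvexOn ℝ Set.univ (V y)) (a : ℝ) :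
    Filter.Tendsto (fun n : ℕ => slope (V y) a (a - 1 / ((n : ℝ) + 1))) Filter.atTop
      (nhds (leftDeriv V y a)) := by
  have h1 := h.hasDerivWithinAt_leftDeriv_of_mem_interior (x := a) (by simp)
  rw [hasDerivWithinAt_iff_tendsto_slope] at h1
  refine h1.comp (tendsto_nhdsWithin_iff.2 ⟨?_, Filter.Eventually.of_forall fun n => ?_⟩)
  · simpa using (tendsto_const_nhds (x := a)).sub
      (tendsto_one_div_add_atTop_nhds_zero_nat (𝕜 := ℝ))
  · have : (0 : ℝ) < 1 / ((n : ℝ) + 1) := by positivity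
    simp only [Set.mem_sdiff, Set.mem_Iio, Set.mem_singleton_iff]
    constructor <;> linarith

/-- A pointwise limit of measurable difference quotients. The first variable ranges over the subtype
because convexity is available only on Y. -/
lemma measurable_leftDeriv {Y : Set ℝ} {V : ℝ → ℝ → ℝ} (hV : Measurable (Function.uncurry V))
    (h : ∀ y ∈ Y, ConvexOn ℝ Set.univ (V y)) :
    Measurable fun q : Y × ℝ => leftDeriv V q.1 q.2 := by
  refine measurable_of_tendsto_metrizable (f := fun (n : ℕ) (q : Y × ℝ) =>
    slope (V q.1) q.2 (q.2 - 1 / ((n : ℝ) + 1))) (fun n => ?_)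
    (tendsto_pi_nhds.2 fun q => tendsto_leftDeriv (h _ q.1.2) q.2)
  simp only [slope_def_field]
  have h1 : Measurable fun q : Y × ℝ => V q.1 q.2 :=
    hV.comp ((measurable_subtype_coe.comp measurable_fst).prodMk measurable_snd)
  have h2 : Measurable fun q : Y × ℝ => V q.1 (q.2 - 1 / ((n : ℝ) + 1)) :=
    hV.comp ((measurable_subtype_coe.comp measurable_fst).prodMk (measurable_snd.sub_const _))
  exact (h2.sub h1).div ((measurable_snd.sub_const _).sub measurable_snd)

/-! ### Lipschitz bounds, empirical risk and descent -/

section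

variable {X : Type u} {Y : Set ℝ} {F : Type v} [NormedAddCommGroup F]
  {V : ℝ → ℝ → ℝ} {Φ : X → F} {κ v₀ a₀ : ℝ}

lemma IsBounded.abs_loss_sub_le (h : IsBounded Y V Φ κ v₀ a₀) {y : ℝ} (hy : y ∈ Y) (a b : ℝ) :
    |V y a - V y b| ≤ a₀ * |a - b| := by
  have key : ∀ a b, V y a - V y b ≤ a₀ * |a - b| := fun a b => by
    have h1 := leftDeriv_mul_sub_le (h.convex y hy) a b
    have h2 : leftDeriv V y a * (a - b) ≤ a₀ * |a - b| := by
      refine (le_abs_self _).trans ?_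
      rw [abs_mul]
      exact mul_le_mul_of_nonneg_right (h.leftDeriv_le y hy a) (abs_nonneg _)
    linarith
  rw [abs_le]
  have h1 := key a b
  have h2 := key b a
  rw [abs_sub_comm] at h2
  constructor <;> linarith

/-- The data point is needed: over an empty space the bounds say nothing about the signs of the
constants. -/
lemma IsBounded.nonneg (h : IsBounded Y V Φ κ v₀ a₀) (hV0 : ∀ y a, 0 ≤ V y a) (p : X × Y) :
    0 ≤ κ ∧ 0 ≤ v₀ ∧ 0 ≤ a₀ :=
  ⟨(norm_nonneg _).trans (h.norm_feature_le p.1), (hV0 _ _).trans (h.loss_zero_le _ p.2.2),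
    (abs_nonneg _).trans (h.leftDeriv_le _ p.2.2 0)⟩

variable [InnerProductSpace ℝ F]

/-- The loss of the linear function with parameter `w` at the data point `p`. -/
noncomputable def pointLoss (V : ℝ → ℝ → ℝ) (Φ : X → F) (w : F) (p : X × Y) : ℝ :=
  V p.2 (inner ℝ w (Φ p.1))

lemma IsBounded.abs_pointLoss_sub_le (h : IsBounded Y V Φ κ v₀ a₀) (hV0 : ∀ y a, 0 ≤ V y a)
    (w w' : F) (p : X × Y) :
    |pointLoss V Φ w p - pointLoss V Φ w' p| ≤ a₀ * κ * ‖w - w'‖ := by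
  refine (h.abs_loss_sub_le p.2.2 _ _).trans ?_
  rw [← inner_sub_left, mul_assoc]
  refine mul_le_mul_of_nonneg_left ?_ (h.nonneg hV0 p).2.2
  refine (abs_real_inner_le_norm _ _).trans ?_
  rw [mul_comm κ]
  exact mul_le_mul_of_nonneg_left (h.norm_feature_le _) (norm_nonneg _)

lemma IsBounded.abs_pointLoss_le (h : IsBounded Y V Φ κ v₀ a₀) (hV0 : ∀ y a, 0 ≤ V y a)
    (w : F) (p : X × Y) : |pointLoss V Φ w p| ≤ v₀ + a₀ * κ * ‖w‖ := by
  have h1 := h.abs_pointLoss_sub_le hV0 w 0 p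
  have h2 : |pointLoss V Φ 0 p| ≤ v₀ := by
    rw [abs_of_nonneg (show 0 ≤ pointLoss V Φ 0 p from hV0 _ _)]
    simpa [pointLoss] using h.loss_zero_le _ p.2.2
  rw [sub_zero] at h1
  have := abs_sub_abs_le_abs_sub (pointLoss V Φ w p) (pointLoss V Φ 0 p)
  linarith

lemma IsBounded.convexOn_pointLoss (h : IsBounded Y V Φ κ v₀ a₀) (p : X × Y) :
    ConvexOn ℝ Set.univ fun w : F => pointLoss V Φ w p := by
  refine ⟨convex_univ, fun w _ w' _ a b ha hb hab => ?_⟩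
  have := (h.convex _ p.2.2).2 (Set.mem_univ (inner ℝ w (Φ p.1)))
    (Set.mem_univ (inner ℝ w' (Φ p.1))) ha hb hab
  simpa [pointLoss, inner_add_left, inner_smul_left] using this

lemma risk_eq [MeasurableSpace X] {ρ : Measure (X × Y)} (w : F) : risk ρ V Φ w = ∫ p, pointLoss V Φ w p ∂ρ := rfl

lemma risk_nonneg [MeasurableSpace X] (ρ : Measure (X × Y)) (hV0 : ∀ y a, 0 ≤ V y a) (w : F) : 0 ≤ risk ρ V Φ w :=
  integral_nonneg fun _ => hV0 _ _

/-- The empirical risk on the sample `z`. -/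
noncomputable def empiricalRisk {m : ℕ} (V : ℝ → ℝ → ℝ) (Φ : X → F) (z : Fin m → X × Y)
    (w : F) : ℝ :=
  (m : ℝ)⁻¹ * ∑ i, pointLoss V Φ w (z i)

lemma IsBounded.convexOn_empiricalRisk (h : IsBounded Y V Φ κ v₀ a₀) {m : ℕ}
    (z : Fin m → X × Y) : ConvexOn ℝ Set.univ (empiricalRisk V Φ z) := by
  have h1 : ConvexOn ℝ Set.univ fun w : F => ∑ i, pointLoss V Φ w (z i) := by
    refine ⟨convex_univ, fun w _ w' _ a b ha hb hab => ?_⟩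
    simp only [smul_eq_mul, Finset.mul_sum, ← Finset.sum_add_distrib]
    exact Finset.sum_le_sum fun i _ =>
      (h.convexOn_pointLoss (z i)).2 (Set.mem_univ w) (Set.mem_univ w') ha hb hab
  exact h1.smul (by positivity : (0 : ℝ) ≤ (m : ℝ)⁻¹)

lemma inv_mul_sum_le_of_le {m : ℕ} {f : Fin m → ℝ} {K : ℝ} (hK : 0 ≤ K) (h : ∀ i, f i ≤ K) :
    (m : ℝ)⁻¹ * ∑ i, f i ≤ K := by
  rcases Nat.eq_zero_or_pos m with rfl | hm
  · simpa
  · have hm' : (0 : ℝ) < m := by exact_mod_cast hm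
    rw [inv_mul_le_iff₀ hm']
    calc ∑ i, f i ≤ ∑ _i : Fin m, K := Finset.sum_le_sum fun i _ => h i
      _ = _ := by simp

lemma IsBounded.abs_empiricalRisk_le (h : IsBounded Y V Φ κ v₀ a₀) (hV0 : ∀ y a, 0 ≤ V y a)
    (hn : 0 ≤ κ ∧ 0 ≤ v₀ ∧ 0 ≤ a₀) {m : ℕ} (z : Fin m → X × Y) (w : F) :
    |empiricalRisk V Φ z w| ≤ v₀ + a₀ * κ * ‖w‖ := by
  obtain ⟨h1, h2, h3⟩ := hn
  rw [empiricalRisk, abs_mul, abs_of_nonneg (by positivity)]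
  refine (mul_le_mul_of_nonneg_left (Finset.abs_sum_le_sum_abs _ _) (by positivity)).trans ?_
  exact inv_mul_sum_le_of_le (by positivity) fun i => h.abs_pointLoss_le hV0 w (z i)

lemma IsBounded.continuous_pointLoss (h : IsBounded Y V Φ κ v₀ a₀) (hV0 : ∀ y a, 0 ≤ V y a)
    (p : X × Y) : Continuous fun w : F => pointLoss V Φ w p :=
  (LipschitzWith.of_dist_le_mul (K := (a₀ * κ).toNNReal) fun w w' => by
    have hn := h.nonneg hV0 p
    rw [Real.dist_eq, dist_eq_norm, Real.coe_toNNReal _ (mul_nonneg hn.2.2 hn.1)]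
    exact h.abs_pointLoss_sub_le hV0 w w' p).continuous

lemma IsBounded.continuous_empiricalRisk (h : IsBounded Y V Φ κ v₀ a₀)
    (hV0 : ∀ y a, 0 ≤ V y a) {m : ℕ} (z : Fin m → X × Y) :
    Continuous (empiricalRisk V Φ z) :=
  continuous_const.mul (continuous_finsetSum _ fun i _ => h.continuous_pointLoss hV0 (z i))

lemma iterate_add_one {m : ℕ} (η : ℕ → ℝ) (z : Fin m → X × Y) (j : ℕ → Fin m) {k : ℕ}
    (hk : 1 ≤ k) :
    iterate V Φ η z j (k + 1) = iterate V Φ η z j k -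
      (η k * leftDeriv V (z (j k)).2 (inner ℝ (iterate V Φ η z j k) (Φ (z (j k)).1))) •
        Φ (z (j k)).1 := by
  obtain ⟨k, rfl⟩ := Nat.exists_eq_add_of_le' hk
  rfl

lemma iterate_one {m : ℕ} (η : ℕ → ℝ) (z : Fin m → X × Y) (j : ℕ → Fin m) :
    iterate V Φ η z j 1 = 0 := rfl

/-- Expanding the square, the cross term is bounded by the subgradient inequality and the quadratic
term by (a₀ κ)². -/
lemma IsBounded.norm_iterate_sub_sq_le (h : IsBounded Y V Φ κ v₀ a₀) {m : ℕ} {η : ℕ → ℝ}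
    (z : Fin m → X × Y) (j : ℕ → Fin m) {k : ℕ} (hk : 1 ≤ k) (hη : 0 ≤ η k) (v : F) :
    ‖iterate V Φ η z j (k + 1) - v‖ ^ 2 ≤ ‖iterate V Φ η z j k - v‖ ^ 2
      - 2 * η k * (pointLoss V Φ (iterate V Φ η z j k) (z (j k)) - pointLoss V Φ v (z (j k)))
      + η k ^ 2 * (a₀ * κ) ^ 2 := by
  rw [iterate_add_one η z j hk]
  set w := iterate V Φ η z j k
  set p := z (j k)
  set l := leftDeriv V p.2 (inner ℝ w (Φ p.1))
  have e : w - (η k * l) • Φ p.1 - v = (w - v) - (η k * l) • Φ p.1 := by abel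
  rw [e, norm_sub_sq_real, inner_smul_right, inner_sub_left, norm_smul, mul_pow,
    Real.norm_eq_abs, sq_abs]
  have h1 := leftDeriv_mul_sub_le (h.convex _ p.2.2) (inner ℝ w (Φ p.1)) (inner ℝ v (Φ p.1))
  have h2 : l ^ 2 * ‖Φ p.1‖ ^ 2 ≤ (a₀ * κ) ^ 2 := by
    rw [← sq_abs l, ← mul_pow]
    exact pow_le_pow_left₀ (by positivity) (mul_le_mul (h.leftDeriv_le _ p.2.2 _)
      (h.norm_feature_le _) (norm_nonneg _)
      ((abs_nonneg _).trans (h.leftDeriv_le _ p.2.2 0))) 2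
  have h3 := mul_le_mul_of_nonneg_left h1 hη
  have h4 := mul_le_mul_of_nonneg_left h2 (sq_nonneg (η k))
  change η k * (l * _) ≤ η k * (pointLoss V Φ v p - pointLoss V Φ w p) at h3
  nlinarith

/-- Descent towards 0: nonnegativity of the loss discards the loss at the iterate, the loss at 0 is
at most v₀, and η² ≤ η. Without any projection, this supplies the radius for the generalization
bound. -/
lemma IsBounded.norm_iterate_sq_le (h : IsBounded Y V Φ κ v₀ a₀) (hV0 : ∀ y a, 0 ≤ V y a)
    {m : ℕ} {η : ℕ → ℝ} (hη : ∀ k, 1 ≤ k → 0 ≤ η k) (hη1 : ∀ k, 1 ≤ k → η k ≤ 1)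
    (z : Fin m → X × Y) (j : ℕ → Fin m) (t : ℕ) :
    ‖iterate V Φ η z j (t + 1)‖ ^ 2 ≤ ((a₀ * κ) ^ 2 + 2 * v₀) * ∑ k ∈ Finset.Icc 1 t, η k := by
  induction t with
  | zero => simp [iterate_one]
  | succ t ih =>
    have h1 := h.norm_iterate_sub_sq_le z j (show 1 ≤ t + 1 by omega) (hη _ (by omega)) 0
    simp only [sub_zero] at h1
    rw [Finset.sum_Icc_succ_top (by omega)]
    have h2 : pointLoss V Φ 0 (z (j (t + 1))) ≤ v₀ := by
      simpa [pointLoss] using h.loss_zero_le _ (z (j (t + 1))).2.2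
    have h3 : 0 ≤ pointLoss V Φ (iterate V Φ η z j (t + 1)) (z (j (t + 1))) := hV0 _ _
    have h4 := hη (t + 1) (by omega)
    have h5 := hη1 (t + 1) (by omega)
    have h6 : η (t + 1) ^ 2 * (a₀ * κ) ^ 2 ≤ η (t + 1) * (a₀ * κ) ^ 2 :=
      mul_le_mul_of_nonneg_right (by nlinarith) (sq_nonneg _)
    nlinarith [mul_le_mul_of_nonneg_left h2 h4, mul_nonneg h4 h3]

lemma IsBounded.norm_iterate_le (h : IsBounded Y V Φ κ v₀ a₀) (hV0 : ∀ y a, 0 ≤ V y a)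
    {m : ℕ} {η : ℕ → ℝ} (hη : ∀ k, 1 ≤ k → 0 ≤ η k) (hη1 : ∀ k, 1 ≤ k → η k ≤ 1)
    (z : Fin m → X × Y) (j : ℕ → Fin m) {k t : ℕ} (hk : 1 ≤ k) (hkt : k ≤ t) :
    ‖iterate V Φ η z j k‖ ≤ √(((a₀ * κ) ^ 2 + 2 * v₀) * ∑ i ∈ Finset.Icc 1 t, η i) := by
  obtain ⟨k, rfl⟩ := Nat.exists_eq_add_of_le' hk
  have hv : 0 ≤ v₀ := (h.nonneg hV0 (z (j 0))).2.1
  refine Real.le_sqrt_of_sq_le ((h.norm_iterate_sq_le hV0 hη hη1 z j k).trans ?_)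
  refine mul_le_mul_of_nonneg_left ?_ (by positivity)
  exact Finset.sum_le_sum_of_subset_of_nonneg (Finset.Icc_subset_Icc_right (by omega))
    fun i hi _ => hη i (Finset.mem_Icc.1 hi).1

lemma IsBounded.norm_averagedIterate_le (h : IsBounded Y V Φ κ v₀ a₀) (hV0 : ∀ y a, 0 ≤ V y a)
    {m : ℕ} {η : ℕ → ℝ} (hη : ∀ k, 1 ≤ k → 0 ≤ η k) (hη1 : ∀ k, 1 ≤ k → η k ≤ 1)
    (z : Fin m → X × Y) (j : ℕ → Fin m) (t : ℕ) :
    ‖averagedIterate V Φ η z j t‖ ≤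
      √(((a₀ * κ) ^ 2 + 2 * v₀) * ∑ i ∈ Finset.Icc 1 t, η i) := by
  set R := √(((a₀ * κ) ^ 2 + 2 * v₀) * ∑ i ∈ Finset.Icc 1 t, η i)
  have hH : 0 ≤ ∑ i ∈ Finset.Icc 1 t, η i :=
    Finset.sum_nonneg fun i hi => hη i (Finset.mem_Icc.1 hi).1
  rw [averagedIterate, norm_smul, Real.norm_eq_abs, abs_of_nonneg (inv_nonneg.2 hH)]
  have h1 : ‖∑ k ∈ Finset.Icc 1 t, η k • iterate V Φ η z j k‖ ≤
      (∑ k ∈ Finset.Icc 1 t, η k) * R := by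
    rw [Finset.sum_mul]
    refine norm_sum_le_of_le _ fun k hk => ?_
    rw [Finset.mem_Icc] at hk
    rw [norm_smul, Real.norm_eq_abs, abs_of_nonneg (hη k hk.1)]
    exact mul_le_mul_of_nonneg_left (h.norm_iterate_le hV0 hη hη1 z j hk.1 hk.2) (hη k hk.1)
  refine (mul_le_mul_of_nonneg_left h1 (inv_nonneg.2 hH)).trans ?_
  rw [← mul_assoc]
  exact mul_le_of_le_one_left (Real.sqrt_nonneg _) inv_mul_le_one

end

/-! ### Measurability and integrability -/

section

variable {X : Type u} [MeasurableSpace X] {Y : Set ℝ} {F : Type v} [NormedAddCommGroup F]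
  [InnerProductSpace ℝ F] [SecondCountableTopology F] [MeasurableSpace F] [BorelSpace F]
  {V : ℝ → ℝ → ℝ} {Φ : X → F} {κ v₀ a₀ : ℝ}

lemma measurable_pointLoss (hV : Measurable (Function.uncurry V)) (hΦ : Measurable Φ) :
    Measurable fun q : F × (X × Y) => pointLoss V Φ q.1 q.2 :=
  hV.comp ((measurable_subtype_coe.comp measurable_snd.snd).prodMk
    (measurable_fst.inner (hΦ.comp measurable_snd.fst)))

lemma measurable_empiricalRisk (hV : Measurable (Function.uncurry V)) (hΦ : Measurable Φ)
    {m : ℕ} : Measurable fun q : F × (Fin m → X × Y) => empiricalRisk V Φ q.2 q.1 :=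
  measurable_const.mul (Finset.measurable_sum _ fun i _ => (measurable_pointLoss hV hΦ).comp
    (measurable_fst.prodMk ((measurable_pi_apply i).comp measurable_snd)))

lemma measurable_iterate (hV : Measurable (Function.uncurry V)) (hΦ : Measurable Φ)
    (h : ∀ y ∈ Y, ConvexOn ℝ Set.univ (V y)) {m : ℕ} (η : ℕ → ℝ) (t : ℕ) :
    Measurable fun p : (Fin m → X × Y) × (ℕ → Fin m) => iterate V Φ η p.1 p.2 t := by
  induction t with
  | zero => exact measurable_const
  | succ t ih =>
    rcases Nat.eq_zero_or_pos t with rfl | ht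
    · exact measurable_const
    · simp only [iterate_add_one η _ _ ht]
      -- The index takes finitely many values, so measurability is checked for each fixed value.
      have hz : Measurable fun p : (Fin m → X × Y) × (ℕ → Fin m) => p.1 (p.2 t) :=
        (measurable_from_prod_countable_left (f := fun q : (Fin m → X × Y) × Fin m => q.1 q.2)
          fun i => measurable_pi_apply i).comp
          (measurable_fst.prodMk ((measurable_pi_apply t).comp measurable_snd))
      have hΦz := hΦ.comp hz.fst
      exact ih.sub ((measurable_const.mul ((measurable_leftDeriv hV h).comp
        (hz.snd.prodMk (ih.inner hΦz)))).smul hΦz)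

lemma measurable_averagedIterate (hV : Measurable (Function.uncurry V)) (hΦ : Measurable Φ)
    (h : ∀ y ∈ Y, ConvexOn ℝ Set.univ (V y)) {m : ℕ} (η : ℕ → ℝ) (t : ℕ) :
    Measurable fun p : (Fin m → X × Y) × (ℕ → Fin m) => averagedIterate V Φ η p.1 p.2 t := by
  unfold averagedIterate
  exact (Finset.measurable_sum _ fun k _ =>
    (measurable_iterate hV hΦ h η k).const_smul (η k)).const_smul _

variable {ρ : Measure (X × Y)} [IsProbabilityMeasure ρ]

lemma IsBounded.integrable_pointLoss (h : IsBounded Y V Φ κ v₀ a₀) (hV0 : ∀ y a, 0 ≤ V y a)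
    (hV : Measurable (Function.uncurry V)) (hΦ : Measurable Φ) (w : F) :
    Integrable (pointLoss V Φ w) ρ :=
  Integrable.of_bound ((measurable_pointLoss hV hΦ).comp
    measurable_prodMk_left).aestronglyMeasurable _
    (Filter.Eventually.of_forall fun p => h.abs_pointLoss_le hV0 w p)

lemma IsBounded.risk_le (h : IsBounded Y V Φ κ v₀ a₀) (hV0 : ∀ y a, 0 ≤ V y a)
    (hV : Measurable (Function.uncurry V)) (hΦ : Measurable Φ) (w : F) :
    risk ρ V Φ w ≤ v₀ + a₀ * κ * ‖w‖ := by
  rw [risk_eq]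
  refine (integral_mono (h.integrable_pointLoss hV0 hV hΦ w) (integrable_const _)
    fun p => (le_abs_self _).trans (h.abs_pointLoss_le hV0 w p)).trans_eq ?_
  simp

lemma IsBounded.continuous_risk (h : IsBounded Y V Φ κ v₀ a₀) (hV0 : ∀ y a, 0 ≤ V y a)
    (hV : Measurable (Function.uncurry V)) (hΦ : Measurable Φ) :
    Continuous (risk ρ V Φ) := by
  have : Nonempty (X × Y) := nonempty_of_isProbabilityMeasure ρ
  have hn := h.nonneg hV0 (Classical.arbitrary (X × Y))
  refine (LipschitzWith.of_dist_le_mul (K := (a₀ * κ).toNNReal) fun w w' => ?_).continuous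
  rw [Real.dist_eq, dist_eq_norm, Real.coe_toNNReal _ (mul_nonneg hn.2.2 hn.1), risk_eq, risk_eq,
    ← integral_sub (h.integrable_pointLoss hV0 hV hΦ w) (h.integrable_pointLoss hV0 hV hΦ w')]
  refine abs_integral_le_integral_abs.trans ?_
  refine (integral_mono ((h.integrable_pointLoss hV0 hV hΦ w).sub
    (h.integrable_pointLoss hV0 hV hΦ w')).abs (integrable_const _)
    fun p => h.abs_pointLoss_sub_le hV0 w w' p).trans_eq ?_
  simp

lemma IsBounded.integral_empiricalRisk (h : IsBounded Y V Φ κ v₀ a₀) (hV0 : ∀ y a, 0 ≤ V y a)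
    (hV : Measurable (Function.uncurry V)) (hΦ : Measurable Φ) {m : ℕ} (hm : 1 ≤ m) (w : F) :
    ∫ z, empiricalRisk V Φ z w ∂(Measure.pi fun _ : Fin m => ρ) = risk ρ V Φ w := by
  unfold empiricalRisk
  have hmeas : Measurable (pointLoss V Φ w : X × Y → ℝ) :=
    (measurable_pointLoss hV hΦ).comp measurable_prodMk_left
  have hint : ∀ i : Fin m, Integrable (fun z : Fin m → X × Y => pointLoss V Φ w (z i))
      (Measure.pi fun _ : Fin m => ρ) := fun i =>
    Integrable.of_bound (hmeas.comp (measurable_pi_apply i)).aestronglyMeasurable _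
      (Filter.Eventually.of_forall fun z => h.abs_pointLoss_le hV0 w (z i))
  rw [integral_const_mul, integral_finsetSum _ fun i _ => hint i]
  have : ∀ i : Fin m, ∫ z : Fin m → X × Y, pointLoss V Φ w (z i)
      ∂(Measure.pi fun _ : Fin m => ρ) = risk ρ V Φ w := fun i =>
    integral_comp_eval (μ := fun _ : Fin m => ρ) hmeas.aestronglyMeasurable
  have hm' : (m : ℝ) ≠ 0 := by positivity
  simp [this, hm']

end

/-! ### Averaging over the random indices -/

/-- The law of the index sequence. -/
noncomputable def indexLaw (m : ℕ) : Measure (ℕ → Fin m) :=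
  Measure.infinitePi fun _ : ℕ => uniformOn (Set.univ : Set (Fin m))

section

variable {m : ℕ} [NeZero m]

instance : IsProbabilityMeasure (uniformOn (Set.univ : Set (Fin m))) :=
  isProbabilityMeasure_uniformOn Set.finite_univ Set.univ_nonempty

instance : IsProbabilityMeasure (indexLaw m) := by
  unfold indexLaw; infer_instance

lemma _root_.DependsOn.exists_eq_comp_restrict_range {α : Type*} {f : (ℕ → Fin m) → α} {k : ℕ}
    (hf : DependsOn f (Set.Iio k)) :
    ∃ g : (Finset.range k → Fin m) → α, ∀ j, f j = g fun i => j i := by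
  refine ⟨fun r => f fun i => if h : i ∈ Finset.range k then r ⟨i, h⟩ else 0, fun j => hf ?_⟩
  intro i hi
  simp only [Set.mem_Iio] at hi
  simp [hi]

/-- Dependence on finitely many indices means factoring through a finite space, where every function
is measurable and integrable. -/
lemma _root_.DependsOn.integrable_indexLaw {f : (ℕ → Fin m) → ℝ} {k : ℕ}
    (hf : DependsOn f (Set.Iio k)) : Integrable f (indexLaw m) := by
  obtain ⟨g, hg⟩ := hf.exists_eq_comp_restrict_range
  have hm : Measurable fun (j : ℕ → Fin m) (i : Finset.range k) => j i :=
    measurable_pi_lambda _ fun i => measurable_pi_apply _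
  have : f = g ∘ fun j i => j i := funext hg
  rw [this]
  have : Integrable g ((indexLaw m).map fun (j : ℕ → Fin m) (i : Finset.range k) => j i) :=
    Integrable.of_finite
  exact this.comp_measurable hm

lemma integral_indicator_index (k : ℕ) (i : Fin m) :
    ∫ j, (if j k = i then (1 : ℝ) else 0) ∂(indexLaw m) = (m : ℝ)⁻¹ := by
  have h := measurePreserving_eval_infinitePi
    (fun _ : ℕ => uniformOn (Set.univ : Set (Fin m))) k
  have e : ∫ j, (if j k = i then (1 : ℝ) else 0) ∂(indexLaw m) =
      ∫ l, (if l = i then (1 : ℝ) else 0) ∂(uniformOn (Set.univ : Set (Fin m))) := by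
    rw [← h.map_eq, integral_map h.measurable.aemeasurable
      (Measurable.of_discrete).aestronglyMeasurable]
    rfl
  rw [e, integral_fintype Integrable.of_finite]
  have : ∀ l : Fin m, (uniformOn (Set.univ : Set (Fin m))).real {l} = (m : ℝ)⁻¹ := by
    intro l
    simp [Measure.real, uniformOn_univ]
  simp [this]

/-- Averaging over the current index, given a dependence on the past indices only. -/
lemma integral_index_eq {f : (ℕ → Fin m) → Fin m → ℝ} {k : ℕ}
    (hf : ∀ i, DependsOn (fun j => f j i) (Set.Iio k)) :
    Integrable (fun j => f j (j k)) (indexLaw m) ∧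
    ∫ j, f j (j k) ∂(indexLaw m) = ∫ j, (m : ℝ)⁻¹ * ∑ i, f j i ∂(indexLaw m) := by
  have hind : iIndepFun (fun (n : ℕ) (j : ℕ → Fin m) => j n) (indexLaw m) :=
    iIndepFun_infinitePi (X := fun _ => id) fun _ => measurable_id
  have hpast := hind.indepFun_finset (Finset.range k) {k} (by simp)
    fun i => measurable_pi_apply i
  -- Splitting by the value of `j k` makes each term a product of a function of the past and a
  -- function of `j k`, to which independence applies.
  have e : ∀ j : ℕ → Fin m, f j (j k) = ∑ i, f j i * (if j k = i then 1 else 0) := fun j => by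
    simp
  have hterm : ∀ i, Integrable (fun j => f j i * (if j k = i then (1 : ℝ) else 0)) (indexLaw m) ∧
      ∫ j, f j i * (if j k = i then 1 else 0) ∂(indexLaw m) =
      (m : ℝ)⁻¹ * ∫ j, f j i ∂(indexLaw m) := by
    intro i
    constructor
    · refine DependsOn.integrable_indexLaw (k := k + 1) fun x y hxy => ?_
      have h1 : f x i = f y i := hf i fun l hl => hxy l (Nat.lt_succ_of_lt hl)
      rw [h1, hxy k (Nat.lt_succ_self k)]
    · obtain ⟨g, hg⟩ := (hf i).exists_eq_comp_restrict_range
      have hI : IndepFun (fun j => f j i) (fun j : ℕ → Fin m => if j k = i then (1 : ℝ) else 0)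
          (indexLaw m) := by
        have := hpast.comp (φ := g)
          (ψ := fun r : (({k} : Finset ℕ) → Fin m) =>
            if r ⟨k, by simp⟩ = i then (1 : ℝ) else 0)
          Measurable.of_discrete Measurable.of_discrete
        convert this using 1
        · exact funext hg
        · rfl
      have hm2 : Measurable fun j : ℕ → Fin m => if j k = i then (1 : ℝ) else 0 :=
        (Measurable.of_discrete (f := fun l : Fin m => if l = i then (1 : ℝ) else 0)).comp
          (measurable_pi_apply k)
      rw [hI.integral_fun_mul_eq_mul_integral (hf i).integrable_indexLaw.aestronglyMeasurable
        hm2.aestronglyMeasurable, integral_indicator_index, mul_comm]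
  simp only [e]
  refine ⟨integrable_finsetSum _ fun i _ => (hterm i).1, ?_⟩
  rw [integral_finsetSum _ fun i _ => (hterm i).1, integral_const_mul,
    integral_finsetSum _ fun i _ => (hf i).integrable_indexLaw, Finset.mul_sum]
  exact Finset.sum_congr rfl fun i _ => (hterm i).2

end

/-! ### Optimization error for a fixed sample -/

section

variable {X : Type u} {Y : Set ℝ} {F : Type v} [NormedAddCommGroup F] [InnerProductSpace ℝ F]
  {V : ℝ → ℝ → ℝ} {Φ : X → F} {κ v₀ a₀ : ℝ} {m : ℕ} {η : ℕ → ℝ}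

/-- The strict bound matters: the index drawn at time t is independent of the iterate it updates. -/
lemma dependsOn_iterate (z : Fin m → X × Y) (t : ℕ) :
    DependsOn (fun j => iterate V Φ η z j t) (Set.Iio t) := by
  induction t with
  | zero => intro _ _ _; rfl
  | succ t ih =>
    rcases Nat.eq_zero_or_pos t with rfl | ht
    · intro _ _ _; rfl
    · intro x y hxy
      have h1 : iterate V Φ η z x t = iterate V Φ η z y t :=
        ih fun i hi => hxy i (Nat.lt_succ_of_lt hi)
      simp only [iterate_add_one η z _ ht, h1, hxy t (Nat.lt_succ_self t)]

variable [NeZero m]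

/-- Expected empirical risk of an iterate, over the choice of the indices. -/
noncomputable def expectedEmpiricalRisk (V : ℝ → ℝ → ℝ) (Φ : X → F) (η : ℕ → ℝ)
    (z : Fin m → X × Y) (k : ℕ) : ℝ :=
  ∫ j, empiricalRisk V Φ z (iterate V Φ η z j k) ∂(indexLaw m)

/-- The comparator may depend on past indices, so that an earlier iterate can be used as `v`. -/
lemma IsBounded.integral_norm_iterate_sub_sq_le (h : IsBounded Y V Φ κ v₀ a₀)
    (z : Fin m → X × Y) {k : ℕ} (hk : 1 ≤ k) (hη : 0 ≤ η k) {v : (ℕ → Fin m) → F}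
    (hv : DependsOn v (Set.Iio k)) :
    ∫ j, ‖iterate V Φ η z j (k + 1) - v j‖ ^ 2 ∂(indexLaw m) ≤
      ∫ j, ‖iterate V Φ η z j k - v j‖ ^ 2 ∂(indexLaw m)
      - 2 * η k * (expectedEmpiricalRisk V Φ η z k -
          ∫ j, empiricalRisk V Φ z (v j) ∂(indexLaw m))
      + η k ^ 2 * (a₀ * κ) ^ 2 := by
  have hw := dependsOn_iterate (V := V) (Φ := Φ) (η := η) z k
  have hpl : ∀ i, DependsOn (fun j => pointLoss V Φ (iterate V Φ η z j k) (z i) -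
      pointLoss V Φ (v j) (z i)) (Set.Iio k) := fun i x y hxy => by
    have h1 := hw hxy
    have h2 := hv hxy
    simp only at h1 h2
    simp only [h1, h2]
  obtain ⟨hint, heq⟩ := integral_index_eq (f := fun j i =>
    pointLoss V Φ (iterate V Φ η z j k) (z i) - pointLoss V Φ (v j) (z i)) hpl
  have hi1 : Integrable (fun j => ‖iterate V Φ η z j (k + 1) - v j‖ ^ 2) (indexLaw m) :=
    DependsOn.integrable_indexLaw (k := k + 1) fun x y hxy => by
      have h1 := dependsOn_iterate (V := V) (Φ := Φ) (η := η) z (k + 1) hxy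
      have h2 : v x = v y := hv fun l hl => hxy l (Nat.lt_succ_of_lt hl)
      simp only at h1
      rw [h1, h2]
  have hi2 : Integrable (fun j => ‖iterate V Φ η z j k - v j‖ ^ 2) (indexLaw m) :=
    DependsOn.integrable_indexLaw (k := k) fun x y hxy => by
      have h1 := hw hxy
      simp only at h1
      rw [h1, hv hxy]
  have hi3 : Integrable (fun j => empiricalRisk V Φ z (iterate V Φ η z j k)) (indexLaw m) :=
    DependsOn.integrable_indexLaw (k := k) fun x y hxy => by
      have h1 := hw hxy
      simp only at h1
      rw [h1]
  have hi4 : Integrable (fun j => empiricalRisk V Φ z (v j)) (indexLaw m) :=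
    DependsOn.integrable_indexLaw (k := k) fun x y hxy => by rw [hv hxy]
  have e : expectedEmpiricalRisk V Φ η z k - ∫ j, empiricalRisk V Φ z (v j) ∂(indexLaw m) =
      ∫ j, (pointLoss V Φ (iterate V Φ η z j k) (z (j k)) - pointLoss V Φ (v j) (z (j k)))
        ∂(indexLaw m) := by
    rw [heq, expectedEmpiricalRisk, ← integral_sub hi3 hi4]
    refine integral_congr_ae (Filter.Eventually.of_forall fun j => ?_)
    simp only [empiricalRisk, Finset.sum_sub_distrib]
    ring
  have hi5 : Integrable (fun j => ‖iterate V Φ η z j k - v j‖ ^ 2 - 2 * η k *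
      (pointLoss V Φ (iterate V Φ η z j k) (z (j k)) - pointLoss V Φ (v j) (z (j k))))
      (indexLaw m) := hi2.sub (hint.const_mul _)
  rw [e, ← integral_const_mul, ← integral_sub hi2 (hint.const_mul _)]
  have hconst : η k ^ 2 * (a₀ * κ) ^ 2 = ∫ _j, η k ^ 2 * (a₀ * κ) ^ 2 ∂(indexLaw m) := by simp
  rw [hconst, ← integral_add hi5 (integrable_const _)]
  exact integral_mono hi1 (hi5.add (integrable_const _))
    fun j => h.norm_iterate_sub_sq_le z j hk hη (v j)

lemma IsBounded.sum_mul_expectedEmpiricalRisk_sub_le (h : IsBounded Y V Φ κ v₀ a₀)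
    (z : Fin m → X × Y) (hη : ∀ k, 1 ≤ k → 0 ≤ η k) {s t : ℕ} (hs : 1 ≤ s) (hst : s ≤ t)
    {v : (ℕ → Fin m) → F} (hv : DependsOn v (Set.Iio s)) :
    ∑ i ∈ Finset.Icc s t, η i * (expectedEmpiricalRisk V Φ η z i -
        ∫ j, empiricalRisk V Φ z (v j) ∂(indexLaw m)) ≤
      (∫ j, ‖iterate V Φ η z j s - v j‖ ^ 2 ∂(indexLaw m)) / 2 +
        (a₀ * κ) ^ 2 / 2 * ∑ i ∈ Finset.Icc s t, η i ^ 2 := by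
  -- The final squared distance is retained so that the induction telescopes; it is dropped
  -- afterwards.
  have key : ∑ i ∈ Finset.Icc s t, η i * (expectedEmpiricalRisk V Φ η z i -
        ∫ j, empiricalRisk V Φ z (v j) ∂(indexLaw m)) +
      (∫ j, ‖iterate V Φ η z j (t + 1) - v j‖ ^ 2 ∂(indexLaw m)) / 2 ≤
      (∫ j, ‖iterate V Φ η z j s - v j‖ ^ 2 ∂(indexLaw m)) / 2 +
        (a₀ * κ) ^ 2 / 2 * ∑ i ∈ Finset.Icc s t, η i ^ 2 := by
    induction t, hst using Nat.le_induction with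
    | base =>
      have := h.integral_norm_iterate_sub_sq_le z hs (hη s hs) hv
      simp only [Finset.Icc_self, Finset.sum_singleton]
      linarith
    | succ t hst ih =>
      have := h.integral_norm_iterate_sub_sq_le z (k := t + 1) (by omega) (hη _ (by omega))
        (hv.mono (Set.Iio_subset_Iio (by omega)))
      rw [Finset.sum_Icc_succ_top (by omega), Finset.sum_Icc_succ_top (by omega)]
      linarith
  have : 0 ≤ ∫ j, ‖iterate V Φ η z j (t + 1) - v j‖ ^ 2 ∂(indexLaw m) :=
    integral_nonneg fun _ => sq_nonneg _
  linarith

/-- The cost of passing from the weighted average to the last iterate. -/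
noncomputable def tailSum (η : ℕ → ℝ) (t : ℕ) : ℝ :=
  ∑ s ∈ Finset.Ico 1 t, η s * (∑ i ∈ Finset.Icc s t, η i ^ 2) /
    ((∑ i ∈ Finset.Icc s t, η i) * ∑ i ∈ Finset.Icc (s + 1) t, η i)

/-- Telescoping from w_1 = 0 leaves ‖u‖² / 2; division by the sum of the steps makes it a penalty
with parameter the inverse of that sum. -/
lemma IsBounded.weighted_average_le (h : IsBounded Y V Φ κ v₀ a₀)
    (z : Fin m → X × Y) (hη : ∀ k, 1 ≤ k → 0 < η k) {t : ℕ} (ht : 1 ≤ t) (u : F) :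
    (∑ i ∈ Finset.Icc 1 t, η i * expectedEmpiricalRisk V Φ η z i) / (∑ i ∈ Finset.Icc 1 t, η i) ≤
      empiricalRisk V Φ z u + (∑ i ∈ Finset.Icc 1 t, η i)⁻¹ / 2 * ‖u‖ ^ 2 +
      (a₀ * κ) ^ 2 / 2 *
        ((∑ i ∈ Finset.Icc 1 t, η i ^ 2) / ∑ i ∈ Finset.Icc 1 t, η i) := by
  have h1 := h.sum_mul_expectedEmpiricalRisk_sub_le z (fun k hk => (hη k hk).le) le_rfl ht
    (v := fun _ => u) (fun _ _ _ => rfl)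
  have hH : 0 < ∑ i ∈ Finset.Icc 1 t, η i :=
    Finset.sum_pos (fun i hi => hη i (Finset.mem_Icc.1 hi).1) ⟨1, by simp [ht]⟩
  simp only [iterate_one, zero_sub, norm_neg, integral_const, probReal_univ, one_smul, mul_sub,
    Finset.sum_sub_distrib, ← Finset.sum_mul] at h1
  rw [div_le_iff₀ hH]
  generalize ∑ i ∈ Finset.Icc 1 t, η i = H at *
  have : (empiricalRisk V Φ z u + H⁻¹ / 2 * ‖u‖ ^ 2 +
      (a₀ * κ) ^ 2 / 2 * ((∑ i ∈ Finset.Icc 1 t, η i ^ 2) / H)) * H =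
      H * empiricalRisk V Φ z u + ‖u‖ ^ 2 / 2 +
        (a₀ * κ) ^ 2 / 2 * ∑ i ∈ Finset.Icc 1 t, η i ^ 2 := by
    field_simp
  rw [this]
  linarith

/-- With the iterate at s as comparator the initial distance vanishes, which is the suffix control
required by `last_le_weighted_average`. -/
lemma IsBounded.expectedEmpiricalRisk_le (h : IsBounded Y V Φ κ v₀ a₀)
    (z : Fin m → X × Y) (hη : ∀ k, 1 ≤ k → 0 < η k) {t : ℕ} (ht : 1 ≤ t) (u : F) :
    expectedEmpiricalRisk V Φ η z t ≤
      empiricalRisk V Φ z u + (∑ i ∈ Finset.Icc 1 t, η i)⁻¹ / 2 * ‖u‖ ^ 2 +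
      (a₀ * κ) ^ 2 / 2 *
        ((∑ i ∈ Finset.Icc 1 t, η i ^ 2) / ∑ i ∈ Finset.Icc 1 t, η i) +
      (a₀ * κ) ^ 2 / 2 * tailSum η t := by
  refine (last_le_weighted_average (e := expectedEmpiricalRisk V Φ η z)
    (B := (a₀ * κ) ^ 2 / 2) hη ht fun s hs hst => ?_).trans
    (add_le_add_left (h.weighted_average_le z hη ht u) _)
  have := h.sum_mul_expectedEmpiricalRisk_sub_le z (fun k hk => (hη k hk).le) hs hst
    (dependsOn_iterate (V := V) (Φ := Φ) (η := η) z s)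
  simpa [expectedEmpiricalRisk] using this

lemma IsBounded.integral_empiricalRisk_averagedIterate_le (h : IsBounded Y V Φ κ v₀ a₀)
    (z : Fin m → X × Y) (hη : ∀ k, 1 ≤ k → 0 < η k) {t : ℕ} (ht : 1 ≤ t) (u : F) :
    ∫ j, empiricalRisk V Φ z (averagedIterate V Φ η z j t) ∂(indexLaw m) ≤
      empiricalRisk V Φ z u + (∑ i ∈ Finset.Icc 1 t, η i)⁻¹ / 2 * ‖u‖ ^ 2 +
      (a₀ * κ) ^ 2 / 2 *
        ((∑ i ∈ Finset.Icc 1 t, η i ^ 2) / ∑ i ∈ Finset.Icc 1 t, η i) := by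
  refine le_trans ?_ (h.weighted_average_le z hη ht u)
  have hH : 0 < ∑ i ∈ Finset.Icc 1 t, η i :=
    Finset.sum_pos (fun i hi => hη i (Finset.mem_Icc.1 hi).1) ⟨1, by simp [ht]⟩
  have hint : ∀ k, Integrable (fun j => empiricalRisk V Φ z (iterate V Φ η z j k))
      (indexLaw m) := fun k =>
    DependsOn.integrable_indexLaw (k := k) fun x y hxy => by
      have h1 := dependsOn_iterate (V := V) (Φ := Φ) (η := η) z k hxy
      simp only at h1
      rw [h1]
  have hav : Integrable (fun j => empiricalRisk V Φ z (averagedIterate V Φ η z j t))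
      (indexLaw m) :=
    DependsOn.integrable_indexLaw (k := t) fun x y hxy => by
      have h1 : ∀ k ∈ Finset.Icc 1 t, η k • iterate V Φ η z x k = η k • iterate V Φ η z y k :=
        fun k hk => by
          have := dependsOn_iterate (V := V) (Φ := Φ) (η := η) z k
            (fun i hi => hxy i (lt_of_lt_of_le hi (Finset.mem_Icc.1 hk).2))
          simp only at this
          rw [this]
      rw [averagedIterate, averagedIterate, Finset.sum_congr rfl h1]
  have hpt : ∀ j, empiricalRisk V Φ z (averagedIterate V Φ η z j t) ≤
      ∑ k ∈ Finset.Icc 1 t, ((∑ i ∈ Finset.Icc 1 t, η i)⁻¹ * η k) *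
        empiricalRisk V Φ z (iterate V Φ η z j k) := fun j => by
    rw [averagedIterate, Finset.smul_sum]
    simp only [smul_smul]
    refine (h.convexOn_empiricalRisk z).map_sum_le (fun k hk => ?_) ?_ fun _ _ => Set.mem_univ _
    · exact mul_nonneg (inv_nonneg.2 hH.le) (hη k (Finset.mem_Icc.1 hk).1).le
    · rw [← Finset.mul_sum, inv_mul_cancel₀ hH.ne']
  refine (integral_mono hav (integrable_finsetSum _ fun k _ => (hint k).const_mul _) hpt).trans_eq
    ?_
  rw [integral_finsetSum _ fun k _ => (hint k).const_mul _, Finset.sum_div]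
  refine Finset.sum_congr rfl fun k _ => ?_
  rw [integral_const_mul, expectedEmpiricalRisk]
  ring

end

/-! ### Generalization error and error decomposition -/

section

variable {X : Type u} [MeasurableSpace X] {Y : Set ℝ} {F : Type v} [NormedAddCommGroup F]
  [InnerProductSpace ℝ F] [SecondCountableTopology F] [MeasurableSpace F] [BorelSpace F]
  {V : ℝ → ℝ → ℝ} {Φ : X → F} {κ v₀ a₀ : ℝ} {ρ : Measure (X × Y)} [IsProbabilityMeasure ρ]

/-- Uniform generalization bound over a ball, for parameters that may depend on the sample. -/
lemma IsBounded.integral_risk_sub_empiricalRisk_le (h : IsBounded Y V Φ κ v₀ a₀)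
    (hV0 : ∀ y a, 0 ≤ V y a) (hV : Measurable (Function.uncurry V)) (hΦ : Measurable Φ)
    {m : ℕ} (hm : 1 ≤ m) {Ω : Type*} [MeasurableSpace Ω] (P : Measure Ω) [IsProbabilityMeasure P]
    {g : (Fin m → X × Y) × Ω → F} {R : ℝ} (hgR : ∀ p, ‖g p‖ ≤ R)
    (hint : Integrable (fun p => risk ρ V Φ (g p) - empiricalRisk V Φ p.1 (g p))
      ((Measure.pi fun _ : Fin m => ρ).prod P)) :
    ∫ p, (risk ρ V Φ (g p) - empiricalRisk V Φ p.1 (g p))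
      ∂((Measure.pi fun _ : Fin m => ρ).prod P) ≤ 2 * (a₀ * κ * R / √m) := by
  set μ := Measure.pi fun _ : Fin m => ρ
  have hne : Nonempty (X × Y) := nonempty_of_isProbabilityMeasure ρ
  have hn := h.nonneg hV0 (Classical.arbitrary (X × Y))
  have hneΩ : Nonempty Ω := nonempty_of_isProbabilityMeasure P
  have hR : 0 ≤ R := (norm_nonneg _).trans
    (hgR (fun _ => Classical.arbitrary (X × Y), Classical.arbitrary Ω))
  have hneB : Nonempty (Metric.closedBall (0 : F) R) := ⟨⟨0, by simp [hR]⟩⟩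
  set d : ℕ → Metric.closedBall (0 : F) R := TopologicalSpace.denseSeq _
  have hd : ∀ n, ‖(d n : F)‖ ≤ R := fun n => mem_closedBall_zero_iff.1 (d n).2
  set l : ℕ → X × Y → ℝ := fun n => pointLoss V Φ (d n : F)
  have hl : ∀ n, Measurable (l n) := fun n =>
    (measurable_pointLoss hV hΦ).comp measurable_prodMk_left
  have hK : ∀ n p, |l n p| ≤ v₀ + a₀ * κ * R := fun n p =>
    (h.abs_pointLoss_le hV0 _ p).trans (add_le_add_right
      (mul_le_mul_of_nonneg_left (hd n) (mul_nonneg hn.2.2 hn.1)) _)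
  have hdev := integral_iSup_deviation_le ρ (m := m) l (B := a₀ * κ * R * √m) hl hK fun z =>
    sum_iSup_sign_le (fun n => (d n : F)) hR hn.1 hn.2.2 hd (fun i => Φ (z i).1)
      (fun i => h.norm_feature_le _) (fun i => V (z i).2)
      (fun i a b => h.abs_loss_sub_le (z i).2.2 a b) (fun i n => hK n (z i))
  set Ψ : (Fin m → X × Y) → ℝ := fun z => ⨆ n, (m * ∫ p, l n p ∂ρ - ∑ i, l n (z i))
  have hm0 : (0 : ℝ) < m := by exact_mod_cast hm
  have hbd : ∀ n (z : Fin m → X × Y), |m * ∫ p, l n p ∂ρ - ∑ i, l n (z i)| ≤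
      2 * (m * (v₀ + a₀ * κ * R)) := by
    intro n z
    have h1 : |∫ p, l n p ∂ρ| ≤ v₀ + a₀ * κ * R := by
      have := norm_integral_le_of_norm_le_const (μ := ρ) (f := l n)
        (Filter.Eventually.of_forall fun p => hK n p)
      simpa using this
    have h2 : |∑ i, l n (z i)| ≤ m * (v₀ + a₀ * κ * R) := by
      simpa [sign] using abs_sum_sign_mul_le (fun i => hK n (z i)) fun _ => true
    have h3 := abs_sub ((m : ℝ) * ∫ p, l n p ∂ρ) (∑ i, l n (z i))
    rw [abs_mul, abs_of_pos hm0] at h3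
    nlinarith [mul_le_mul_of_nonneg_left h1 hm0.le]
  have hΨ : Integrable Ψ μ := integrable_iSup_of_abs_le (fun n => measurable_const.sub
    (Finset.measurable_sum _ fun i _ => (hl n).comp (measurable_pi_apply i))) hbd
  -- Both risks are continuous in w, so the bound passes from the dense sequence to the ball.
  -- Holding for every w at once, it allows `g` to depend on the sample and the indices.
  have hpt : ∀ (z : Fin m → X × Y) (w : F), ‖w‖ ≤ R →
      risk ρ V Φ w - empiricalRisk V Φ z w ≤ (m : ℝ)⁻¹ * Ψ z := by
    intro z w hw
    refine (TopologicalSpace.denseRange_denseSeq (Metric.closedBall (0 : F) R)).induction_on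
      (p := fun x => risk ρ V Φ (x : F) - empiricalRisk V Φ z (x : F) ≤ (m : ℝ)⁻¹ * Ψ z)
      ⟨w, by simpa using hw⟩ ?_ fun n => ?_
    · exact isClosed_le (((h.continuous_risk hV0 hV hΦ).comp continuous_subtype_val).sub
        ((h.continuous_empiricalRisk hV0 z).comp continuous_subtype_val)) continuous_const
    · have := le_ciSup (bddAbove_range_of_abs_le fun n => hbd n z) n
      refine le_trans (le_of_eq ?_) (mul_le_mul_of_nonneg_left this (inv_nonneg.2 hm0.le))
      rw [mul_sub, inv_mul_cancel_left₀ hm0.ne']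
      rfl
  calc _ ≤ ∫ p, (m : ℝ)⁻¹ * Ψ p.1 ∂(μ.prod P) :=
        integral_mono hint ((hΨ.comp_fst P).const_mul _) fun p => hpt p.1 _ (hgR p)
    _ = (m : ℝ)⁻¹ * ∫ z, Ψ z ∂μ := by
        rw [integral_const_mul, integral_fun_fst]; simp
    _ ≤ (m : ℝ)⁻¹ * (2 * (a₀ * κ * R * √m)) :=
        mul_le_mul_of_nonneg_left hdev (inv_nonneg.2 hm0.le)
    _ = _ := by
        have h1 : (√m : ℝ) ≠ 0 := (Real.sqrt_pos.2 hm0).ne'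
        have h2 : (m : ℝ) = √m * √m := (Real.mul_self_sqrt hm0.le).symm
        nth_rewrite 1 [h2]
        field_simp

/-- From a bound on the expected empirical risk to a bound on the expected excess risk. -/
lemma IsBounded.integral_excessRisk_le (h : IsBounded Y V Φ κ v₀ a₀)
    (hV0 : ∀ y a, 0 ≤ V y a) (hV : Measurable (Function.uncurry V)) (hΦ : Measurable Φ)
    {m : ℕ} [NeZero m] {g : (Fin m → X × Y) → (ℕ → Fin m) → F}
    (hg : Measurable fun p : (Fin m → X × Y) × (ℕ → Fin m) => g p.1 p.2)
    {R l E : ℝ} (hgR : ∀ z j, ‖g z j‖ ≤ R)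
    (hopt : ∀ z u, ∫ j, empiricalRisk V Φ z (g z j) ∂(indexLaw m) ≤
      empiricalRisk V Φ z u + l / 2 * ‖u‖ ^ 2 + E) :
    Integrable (fun p => excessRisk ρ V Φ (g p.1 p.2)) (law ρ m) ∧
    ∫ p, excessRisk ρ V Φ (g p.1 p.2) ∂(law ρ m) ≤
      approxError ρ V Φ l + E + 2 * (a₀ * κ * R / √m) := by
  have hlaw : law ρ m = (Measure.pi fun _ : Fin m => ρ).prod (indexLaw m) := rfl
  set μ := Measure.pi fun _ : Fin m => ρ
  have hne : Nonempty (X × Y) := nonempty_of_isProbabilityMeasure ρ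
  have hn := h.nonneg hV0 (Classical.arbitrary (X × Y))
  have hm : 1 ≤ m := Nat.one_le_iff_ne_zero.2 (NeZero.ne m)
  have hKR : ∀ z j, v₀ + a₀ * κ * ‖g z j‖ ≤ v₀ + a₀ * κ * R := fun z j =>
    add_le_add_right (mul_le_mul_of_nonneg_left (hgR z j) (mul_nonneg hn.2.2 hn.1)) _
  have hir : Integrable (fun p => risk ρ V Φ (g p.1 p.2)) (μ.prod (indexLaw m)) :=
    Integrable.of_bound ((h.continuous_risk hV0 hV hΦ).measurable.comp hg).aestronglyMeasurable
      (v₀ + a₀ * κ * R) (Filter.Eventually.of_forall fun p => by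
        rw [Real.norm_eq_abs, abs_of_nonneg (risk_nonneg ρ hV0 _)]
        exact (h.risk_le hV0 hV hΦ _).trans (hKR _ _))
  have hie : Integrable (fun p => empiricalRisk V Φ p.1 (g p.1 p.2)) (μ.prod (indexLaw m)) :=
    Integrable.of_bound ((measurable_empiricalRisk hV hΦ).comp
      (hg.prodMk measurable_fst)).aestronglyMeasurable
      (v₀ + a₀ * κ * R) (Filter.Eventually.of_forall fun p =>
        (h.abs_empiricalRisk_le hV0 hn _ _).trans (hKR _ _))
  have hgen := h.integral_risk_sub_empiricalRisk_le hV0 hV hΦ hm (indexLaw m)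
    (g := fun p => g p.1 p.2) (fun p => hgR _ _) (hir.sub hie)
  have hemp : ∀ u : F, ∫ p, empiricalRisk V Φ p.1 (g p.1 p.2) ∂(μ.prod (indexLaw m)) ≤
      risk ρ V Φ u + l / 2 * ‖u‖ ^ 2 + E := by
    intro u
    have hiu : Integrable (fun z : Fin m → X × Y => empiricalRisk V Φ z u) μ :=
      Integrable.of_bound ((measurable_empiricalRisk hV hΦ).comp
        measurable_prodMk_left).aestronglyMeasurable _
        (Filter.Eventually.of_forall fun z => h.abs_empiricalRisk_le hV0 hn z u)
    rw [integral_prod _ hie, ← h.integral_empiricalRisk hV0 hV hΦ hm u, add_assoc]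
    have hc : l / 2 * ‖u‖ ^ 2 + E = ∫ _z : Fin m → X × Y, (l / 2 * ‖u‖ ^ 2 + E) ∂μ := by simp
    rw [hc, ← integral_add hiu (integrable_const _)]
    refine integral_mono hie.integral_prod_left (hiu.add (integrable_const _)) fun z => ?_
    simpa [add_assoc] using hopt z u
  rw [hlaw]
  refine ⟨hir.sub (integrable_const _), ?_⟩
  -- The infimum over u is taken only after integration; no minimizer needs to exist.
  have hinf : ∫ p, empiricalRisk V Φ p.1 (g p.1 p.2) ∂(μ.prod (indexLaw m)) - E ≤
      ⨅ u : F, (risk ρ V Φ u + l / 2 * ‖u‖ ^ 2) :=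
    le_ciInf fun u => by linarith [hemp u]
  rw [integral_sub hir hie] at hgen
  simp only [excessRisk]
  rw [integral_sub hir (integrable_const _)]
  simp only [integral_const, probReal_univ, one_smul, approxError]
  linarith

end

/-! ### Rates for polynomial step-sizes -/

open Real Finset in
lemma tailSum_le {θ : ℝ} (h0 : 0 ≤ θ) (h1 : θ ≤ 2 / 3) {η : ℕ → ℝ}
    (hη : ∀ t : ℕ, 1 ≤ t → η t = (t : ℝ) ^ (-θ)) {t : ℕ} (ht : 1 ≤ t) :
    tailSum η t ≤ 16 * ((t : ℝ) ^ (-(min θ (1 - θ))) * (1 + log t)) := by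
  refine le_of_eq_of_le (sum_congr rfl fun s hs => ?_) (tail_le h0 h1 ht)
  rw [mem_Ico] at hs
  have e : ∀ r, 1 ≤ r → ∀ i ∈ Icc r t, η i = (i : ℝ) ^ (-θ) := fun r hr i hi =>
    hη i (hr.trans (mem_Icc.1 hi).1)
  rw [hη s hs.1, sum_congr rfl (e s hs.1), sum_congr rfl (e (s + 1) (by omega)),
    sum_congr rfl fun i hi => by rw [e s hs.1 i hi]]

lemma tailSum_nonneg {η : ℕ → ℝ} (hη : ∀ k, 1 ≤ k → 0 ≤ η k) (t : ℕ) : 0 ≤ tailSum η t := by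
  have hsum : ∀ s, 1 ≤ s → 0 ≤ ∑ i ∈ Finset.Icc s t, η i := fun s hs =>
    Finset.sum_nonneg fun i hi => hη i (hs.trans (Finset.mem_Icc.1 hi).1)
  refine Finset.sum_nonneg fun s hs => ?_
  have hs1 := (Finset.mem_Ico.1 hs).1
  exact div_nonneg (mul_nonneg (hη s hs1) (Finset.sum_nonneg fun i _ => sq_nonneg _))
    (mul_nonneg (hsum s hs1) (hsum (s + 1) (by omega)))

section

variable {X : Type u} [MeasurableSpace X] {Y : Set ℝ} {F : Type v} [NormedAddCommGroup F]
  [InnerProductSpace ℝ F] [SecondCountableTopology F] [MeasurableSpace F] [BorelSpace F]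
  {V : ℝ → ℝ → ℝ} {Φ : X → F} {κ v₀ a₀ : ℝ} {ρ : Measure (X × Y)} [IsProbabilityMeasure ρ]

/-- Error decomposition for the last iterate and for the weighted averages. -/
lemma IsBounded.integral_excessRisk_sgm_le (h : IsBounded Y V Φ κ v₀ a₀)
    (hV0 : ∀ y a, 0 ≤ V y a) (hV : Measurable (Function.uncurry V)) (hΦ : Measurable Φ)
    {m : ℕ} [NeZero m] {η : ℕ → ℝ} (hη : ∀ k, 1 ≤ k → 0 < η k) (hη1 : ∀ k, 1 ≤ k → η k ≤ 1)
    {g : (Fin m → X × Y) → (ℕ → Fin m) → ℕ → F}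
    (hg : g = averagedIterate V Φ η ∨ g = iterate V Φ η) {t : ℕ} (ht : 1 ≤ t) :
    Integrable (fun p => excessRisk ρ V Φ (g p.1 p.2 t)) (law ρ m) ∧
    ∫ p, excessRisk ρ V Φ (g p.1 p.2 t) ∂(law ρ m) ≤
      approxError ρ V Φ (∑ i ∈ Finset.Icc 1 t, η i)⁻¹ +
      (a₀ * κ) ^ 2 / 2 *
        ((∑ i ∈ Finset.Icc 1 t, η i ^ 2) / (∑ i ∈ Finset.Icc 1 t, η i) + tailSum η t) +
      2 * (a₀ * κ * √(((a₀ * κ) ^ 2 + 2 * v₀) * ∑ i ∈ Finset.Icc 1 t, η i) / √m) := by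
  have hη0 : ∀ k, 1 ≤ k → 0 ≤ η k := fun k hk => (hη k hk).le
  rcases hg with rfl | rfl
  · refine h.integral_excessRisk_le hV0 hV hΦ
      (measurable_averagedIterate hV hΦ h.convex η t)
      (fun z j => h.norm_averagedIterate_le hV0 hη0 hη1 z j t) fun z u => ?_
    have h1 := h.integral_empiricalRisk_averagedIterate_le z hη ht u
    -- The averages incur no tail cost; it is added so that both methods share one bound.
    have h2 := mul_nonneg (show 0 ≤ (a₀ * κ) ^ 2 / 2 by positivity) (tailSum_nonneg hη0 t)
    rw [mul_add]
    linarith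
  · refine h.integral_excessRisk_le hV0 hV hΦ
      (measurable_iterate hV hΦ h.convex η t)
      (fun z j => h.norm_iterate_le hV0 hη0 hη1 z j ht le_rfl) fun z u => ?_
    have h1 := h.expectedEmpiricalRisk_le z hη ht u
    rw [expectedEmpiricalRisk] at h1
    rw [mul_add]
    linarith

open Real in
/-- Rates for polynomially decaying step-sizes, with explicit constants. -/
lemma IsBounded.integral_excessRisk_sgm_rpow_le (h : IsBounded Y V Φ κ v₀ a₀)
    (hV0 : ∀ y a, 0 ≤ V y a) (hV : Measurable (Function.uncurry V)) (hΦ : Measurable Φ)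
    {β c : ℝ} (hβ0 : 0 < β) (hβ1 : β ≤ 1) (hc : 0 < c)
    (hD : ∀ l : ℝ, 0 < l → approxError ρ V Φ l ≤ c * l ^ β)
    {m : ℕ} [NeZero m] {η : ℕ → ℝ}
    (hη : ∀ t : ℕ, 1 ≤ t → η t = (t : ℝ) ^ (-(2 * β / (2 * β + 1))))
    {g : (Fin m → X × Y) → (ℕ → Fin m) → ℕ → F}
    (hg : g = averagedIterate V Φ η ∨ g = iterate V Φ η) {t : ℕ} (ht : 1 ≤ t) :
    Integrable (fun p => excessRisk ρ V Φ (g p.1 p.2 t)) (law ρ m) ∧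
    ∫ p, excessRisk ρ V Φ (g p.1 p.2 t) ∂(law ρ m) ≤
      c * (t : ℝ) ^ (-(β / (2 * β + 1))) +
      (a₀ * κ) ^ 2 / 2 * (17 * ((t : ℝ) ^ (-(min (2 * β) 1 / (2 * β + 1))) * (1 + log t))) +
      2 * (a₀ * κ * √(3 * ((a₀ * κ) ^ 2 + 2 * v₀))) *
        ((m : ℝ) ^ (-(1 / 2 : ℝ)) * (t : ℝ) ^ (1 / (4 * β + 2))) := by
  have hne : Nonempty (X × Y) := nonempty_of_isProbabilityMeasure ρ
  have hn := h.nonneg hV0 (Classical.arbitrary (X × Y))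
  have hb : 0 < 2 * β + 1 := by linarith
  set θ := 2 * β / (2 * β + 1) with hθ
  have hθ0 : 0 ≤ θ := by positivity
  have hθ1 : θ ≤ 2 / 3 := by rw [hθ, div_le_div_iff₀ hb (by norm_num)]; linarith
  have hθ' : 1 - θ = 1 / (2 * β + 1) := by rw [hθ]; field_simp; ring
  have hmin : min θ (1 - θ) = min (2 * β) 1 / (2 * β + 1) := by
    rw [hθ', hθ, min_div_div_right hb.le]
  have ht0 : (0 : ℝ) < t := by exact_mod_cast ht
  have ht1 : (1 : ℝ) ≤ t := by exact_mod_cast ht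
  have hm0 : (0 : ℝ) < m := by exact_mod_cast Nat.pos_of_ne_zero (NeZero.ne m)
  have hpos : ∀ k, 1 ≤ k → 0 < η k := fun k hk => by
    have : (0 : ℝ) < k := by exact_mod_cast hk
    rw [hη k hk]; positivity
  have hle1 : ∀ k, 1 ≤ k → η k ≤ 1 := fun k hk => by
    rw [hη k hk]
    exact rpow_le_one_of_one_le_of_nonpos (by exact_mod_cast hk) (by linarith)
  obtain ⟨hint, hbound⟩ := h.integral_excessRisk_sgm_le (ρ := ρ) hV0 hV hΦ hpos hle1 hg ht
  refine ⟨hint, hbound.trans ?_⟩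
  have eH : ∑ i ∈ Finset.Icc 1 t, η i = ∑ i ∈ Finset.Icc 1 t, (i : ℝ) ^ (-θ) :=
    Finset.sum_congr rfl fun i hi => hη i (Finset.mem_Icc.1 hi).1
  have eQ : ∑ i ∈ Finset.Icc 1 t, η i ^ 2 = ∑ i ∈ Finset.Icc 1 t, ((i : ℝ) ^ (-θ)) ^ 2 :=
    Finset.sum_congr rfl fun i hi => by rw [hη i (Finset.mem_Icc.1 hi).1]
  have hHlow := rpow_one_sub_le_sum hθ0 ht
  have hHup : ∑ i ∈ Finset.Icc 1 t, (i : ℝ) ^ (-θ) ≤ 3 * (t : ℝ) ^ (1 - θ) := by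
    refine (sum_rpow_neg_le hθ0 (by linarith) t).trans ?_
    rw [div_le_iff₀ (by linarith)]
    have : 0 < (t : ℝ) ^ (1 - θ) := by positivity
    nlinarith
  have hQ := sum_sq_mul_rpow_le θ ht
  have hT := tailSum_le hθ0 hθ1 hη ht
  rw [hmin] at hQ hT
  rw [eH, eQ]
  set H := ∑ i ∈ Finset.Icc 1 t, (i : ℝ) ^ (-θ)
  set Q := ∑ i ∈ Finset.Icc 1 t, ((i : ℝ) ^ (-θ)) ^ 2
  have hQ0 : 0 ≤ Q := Finset.sum_nonneg fun i _ => sq_nonneg _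
  have hp : 0 < (t : ℝ) ^ (1 - θ) := by positivity
  have hH0 : 0 < H := hp.trans_le hHlow
  refine add_le_add (add_le_add ?_ (mul_le_mul_of_nonneg_left ?_ (by positivity))) ?_
  · refine (hD _ (inv_pos.2 hH0)).trans (mul_le_mul_of_nonneg_left ?_ hc.le)
    calc (H⁻¹) ^ β ≤ (((t : ℝ) ^ (1 - θ))⁻¹) ^ β := by gcongr
      _ = _ := by
        rw [← rpow_neg ht0.le, ← rpow_mul ht0.le, hθ']; congr 1; field_simp
  -- This quotient contributes 1 and the tail sum 16 to the factor 17.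
  · have : Q / H ≤ Q * (t : ℝ) ^ (-(1 - θ)) := by
      rw [rpow_neg ht0.le, div_eq_mul_inv]
      gcongr
    linarith
  · have h1 : √(((a₀ * κ) ^ 2 + 2 * v₀) * H) ≤
        √(3 * ((a₀ * κ) ^ 2 + 2 * v₀)) * (t : ℝ) ^ (1 / (4 * β + 2)) := by
      have e : (t : ℝ) ^ (1 / (4 * β + 2)) = √((t : ℝ) ^ (1 - θ)) := by
        rw [sqrt_eq_rpow, ← rpow_mul ht0.le, hθ']; congr 1; field_simp; ring
      rw [e, ← sqrt_mul (by have := hn.2.1; positivity)]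
      refine sqrt_le_sqrt ?_
      have := mul_le_mul_of_nonneg_left hHup
        (show 0 ≤ (a₀ * κ) ^ 2 + 2 * v₀ by have := hn.2.1; positivity)
      linarith
    have h2 : (m : ℝ) ^ (-(1 / 2 : ℝ)) = (√m)⁻¹ := by
      rw [rpow_neg hm0.le, sqrt_eq_rpow]
    have hG : 0 ≤ a₀ * κ := mul_nonneg hn.2.2 hn.1
    rw [h2, div_eq_mul_inv]
    calc _ ≤ 2 * (a₀ * κ * (√(3 * ((a₀ * κ) ^ 2 + 2 * v₀)) * (t : ℝ) ^ (1 / (4 * β + 2))) *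
          (√m)⁻¹) := by gcongr
      _ = _ := by ring

end

end SGM

/-! ### Absorbing the constants -/

open Real in
theorem corollary8 (κ v₀ a₀ c : ℝ) (hc : 0 < c) :
    ∃ C : ℝ, 0 < C ∧
      ∀ (X : Type u) [MeasurableSpace X] (Y : Set ℝ)
        (F : Type v) [NormedAddCommGroup F] [InnerProductSpace ℝ F] [CompleteSpace F]
        [TopologicalSpace.SeparableSpace F] [MeasurableSpace F] [BorelSpace F]
        (ρ : MeasureTheory.Measure (X × Y)) [MeasureTheory.IsProbabilityMeasure ρ]
        (V : ℝ → ℝ → ℝ) (Φ : X → F) (β : ℝ),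
        Measurable (Function.uncurry V) → (∀ y a, 0 ≤ V y a) → Measurable Φ →
        SGM.IsBounded Y V Φ κ v₀ a₀ →
        0 < β → β ≤ 1 →
        (∀ l : ℝ, 0 < l → SGM.approxError ρ V Φ l ≤ c * l ^ β) →
        ∀ (η : ℕ → ℝ), (∀ t : ℕ, 1 ≤ t → η t = (t : ℝ) ^ (-(2 * β / (2 * β + 1)))) →
        ∀ (m : ℕ), 1 ≤ m →
        ∀ g : (Fin m → X × Y) → (ℕ → Fin m) → ℕ → F,
          (g = SGM.averagedIterate V Φ η ∨ g = SGM.iterate V Φ η) →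
          (∀ t : ℕ, 1 ≤ t →
            MeasureTheory.Integrable
              (fun p => SGM.excessRisk ρ V Φ (g p.1 p.2 t)) (SGM.law ρ m) ∧
            ∫ p, SGM.excessRisk ρ V Φ (g p.1 p.2 t) ∂(SGM.law ρ m) ≤
              C * ((m : ℝ) ^ (-(1 / 2 : ℝ)) * (t : ℝ) ^ (1 / (4 * β + 2)) * Real.log t
                + (t : ℝ) ^ (-(min (2 * β) 1 / (2 * β + 1))) * Real.log t
                + (t : ℝ) ^ (-(β / (2 * β + 1))))) ∧
          (2 ≤ m →
            ∫ p, SGM.excessRisk ρ V Φ (g p.1 p.2 m) ∂(SGM.law ρ m) ≤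
              C * ((m : ℝ) ^ (-(β / (2 * β + 1))) * Real.log m)) := by
  -- The constants are fixed before any hypothesis gives their signs; the absolute value keeps S
  -- nonnegative.
  set S := |a₀ * κ * √(3 * ((a₀ * κ) ^ 2 + 2 * v₀))| with hS
  have hS0 : 0 ≤ S := abs_nonneg _
  set G := (a₀ * κ) ^ 2 with hG
  have hG0 : 0 ≤ G := sq_nonneg _
  refine ⟨4 * (c + 26 * G + 4 * S), by positivity, ?_⟩
  intro X _ Y F _ _ _ _ _ _ ρ _ V Φ β hV hV0 hΦ h hβ0 hβ1 hD η hη m hm g hg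
  have : SecondCountableTopology F := UniformSpace.secondCountable_of_separable F
  have : NeZero m := ⟨by omega⟩
  have hm1 : (1 : ℝ) ≤ m := by exact_mod_cast hm
  have hm0 : (0 : ℝ) < m := by linarith
  have half_le_log : ∀ t : ℕ, 2 ≤ t → 1 / 2 ≤ log (t : ℝ) := fun t ht => by
    have h1 := log_le_log (by norm_num) (show (2 : ℝ) ≤ t by exact_mod_cast ht)
    linarith [log_two_gt_d9]
  have first : ∀ t : ℕ, 1 ≤ t →
      MeasureTheory.Integrable
        (fun p => SGM.excessRisk ρ V Φ (g p.1 p.2 t)) (SGM.law ρ m) ∧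
      ∫ p, SGM.excessRisk ρ V Φ (g p.1 p.2 t) ∂(SGM.law ρ m) ≤
        (c + 26 * G + 4 * S) * ((m : ℝ) ^ (-(1 / 2 : ℝ)) * (t : ℝ) ^ (1 / (4 * β + 2)) * log t
          + (t : ℝ) ^ (-(min (2 * β) 1 / (2 * β + 1))) * log t
          + (t : ℝ) ^ (-(β / (2 * β + 1)))) := by
    intro t ht
    obtain ⟨hint, hbound⟩ :=
      h.integral_excessRisk_sgm_rpow_le (ρ := ρ) hV0 hV hΦ hβ0 hβ1 hc hD hη hg ht
    refine ⟨hint, hbound.trans ?_⟩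
    have ht0 : (0 : ℝ) < t := by exact_mod_cast ht
    have hA1 : 0 < (m : ℝ) ^ (-(1 / 2 : ℝ)) * (t : ℝ) ^ (1 / (4 * β + 2)) := by positivity
    have hs := mul_le_mul_of_nonneg_right
      (le_abs_self (a₀ * κ * √(3 * ((a₀ * κ) ^ 2 + 2 * v₀)))) hA1.le
    rw [← hS] at hs
    -- At t = 1 the logarithms vanish and the last term, equal to 1, absorbs everything. For t ≥ 2,
    -- log t ≥ 1/2 gives 1 + log t ≤ 3 log t, whence 17/2 · 3 ≤ 26 and 2 · 2 = 4.
    rcases ht.eq_or_lt with rfl | ht2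
    · have : (m : ℝ) ^ (-(1 / 2 : ℝ)) ≤ 1 :=
        rpow_le_one_of_one_le_of_nonpos hm1 (by norm_num)
      simp only [Nat.cast_one, one_rpow, log_one, mul_one, mul_zero, add_zero, zero_add] at hs ⊢
      nlinarith
    · have hlog := half_le_log t ht2
      have hA2 : 0 < (t : ℝ) ^ (-(min (2 * β) 1 / (2 * β + 1))) := by positivity
      have hA3 : 0 < (t : ℝ) ^ (-(β / (2 * β + 1))) := by positivity
      set A1 := (m : ℝ) ^ (-(1 / 2 : ℝ)) * (t : ℝ) ^ (1 / (4 * β + 2))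
      set A2 := (t : ℝ) ^ (-(min (2 * β) 1 / (2 * β + 1)))
      set A3 := (t : ℝ) ^ (-(β / (2 * β + 1)))
      set L := log (t : ℝ)
      have hL0 : 0 ≤ L := by linarith
      have k1 : S * A1 ≤ 2 * (S * (A1 * L)) := by
        nlinarith [mul_le_mul_of_nonneg_left hlog (mul_nonneg hS0 hA1.le)]
      have k2 : G * (A2 * (1 + L)) ≤ 3 * (G * (A2 * L)) := by
        nlinarith [mul_le_mul_of_nonneg_left hlog (mul_nonneg hG0 hA2.le)]
      have p1 : 0 ≤ (c + 26 * G) * (A1 * L) := by positivity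
      have p2 : 0 ≤ (c + 4 * S) * (A2 * L) := by positivity
      have p3 : 0 ≤ (26 * G + 4 * S) * A3 := by positivity
      have p4 : 0 ≤ G * (A2 * L) := by positivity
      nlinarith
  refine ⟨fun t ht => ⟨(first t ht).1, (first t ht).2.trans ?_⟩, fun hm2 => ?_⟩
  · have ht1 : (1 : ℝ) ≤ t := by exact_mod_cast ht
    have hlog : 0 ≤ log (t : ℝ) := log_nonneg ht1
    refine mul_le_mul_of_nonneg_right ?_ (by positivity)
    have : 0 ≤ c + 26 * G + 4 * S := by positivity
    linarith
  · refine (first m hm).2.trans ?_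
    have hb : 0 < 2 * β + 1 := by linarith
    have hlog := half_le_log m hm2
    have e1 : (m : ℝ) ^ (-(1 / 2 : ℝ)) * (m : ℝ) ^ (1 / (4 * β + 2)) =
        (m : ℝ) ^ (-(β / (2 * β + 1))) := by
      rw [← rpow_add hm0]; congr 1; field_simp; ring
    -- At t = m the first two terms are each at most m^(-β / (2β + 1)) log m and the third at most
    -- twice that, so the factor 4 suffices.
    have e2 : (m : ℝ) ^ (-(min (2 * β) 1 / (2 * β + 1))) ≤ (m : ℝ) ^ (-(β / (2 * β + 1))) := by
      refine rpow_le_rpow_of_exponent_le hm1 (neg_le_neg ?_)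
      exact div_le_div_of_nonneg_right (le_min (by linarith) hβ1) hb.le
    rw [e1, mul_comm 4 (c + 26 * G + 4 * S), mul_assoc (c + 26 * G + 4 * S)]
    refine mul_le_mul_of_nonneg_left ?_ (by positivity)
    have hA3 : 0 < (m : ℝ) ^ (-(β / (2 * β + 1))) := by positivity
    nlinarith [mul_le_mul_of_nonneg_right e2 (show 0 ≤ log (m : ℝ) by linarith),
      mul_le_mul_of_nonneg_left hlog hA3.le]
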